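/- For $\Re z>0$ let $\theta(z)=\sum_{n\in\mathbf Z}e^{-\pi n^2z}$, and for $s\in\mathbf C\setminus\{0\}$ let $$\Lambda(s)=-\frac1s+\int_1^\infty x^{s/2}\,\frac{\theta(x)-1}{2}\,\frac{dx}{x};$$ $s\Lambda(s)$ extends to an entire function with value $-1$ at $s=0$. Let $Z(t)=e^{i\vartheta(t)}\zeta(\tfrac12+it)$ be the Riemann–Siegel function, where $\pi^{-s/2}\Gamma(s/2)=|\pi^{-s/2}\Gamma(s/2)|\,e^{i\vartheta(t)}$ for $s=\tfrac12+it$, $t\in\mathbf R$. The zeros of the entire function $s\Lambda(s)$, repeated according to multiplicity, can be enumerated as $(b_n)_{n\in\mathbf Z}$ with $b_0$ real, $b_n$ not real for $n\ne0$, $b_{-n}=\overline{b_n}$, and $|b_n|\le|b_{n+1}|$ for $n\ge1$. For the real constant $\alpha=\int_1^\infty\frac{\theta(x)-1}{2}\frac{dx}{x}$ and every such enumeration, $$\Lambda(s)=-\frac{e^{-\alpha s}}{s}\prod_{n\in\mathbf Z}\Bigl(1-\frac{s}{b_n}\Bigr)e^{s/b_n}\qquad(s\ne0),$$ with an unconditionally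 convergent product. The function $\Lambda$ does not vanish on the line $\Re s=\tfrac12$; there is a continuous determination of $\arg\Lambda(\tfrac12+it)$, $t\in\mathbf R$, with $|\arg\Lambda(\tfrac12+it)-\tfrac\pi2|<0.19$ for all $t>10$; and there is a real function $u(t)$ with $u(t)>0$ for $t>0$, such that for every such enumeration and all real $t$, with $s=\tfrac12+it$, $$Z(t)=u(t)\Bigl\{-\frac\pi2+\alpha t+\arctan 2t-\sum_{n\in\mathbf Z}\Bigl[\arg\Bigl(1-\frac{s}{b_n}\Bigr)+\Im\frac{s}{b_n}\Bigr]\Bigr\}.$$ Here no $1-s/b_n$ lies in $(-\infty,0]$, $\arg(1-s/b_n)\in(-\pi,\pi)$ is the principal value, and the series converges absolutely. Moreover, the expression in braces equals $\frac\pi2-\arg\Lambda(\tfrac12+it)$ for all real $t$. -/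

import Mathlib

namespace RiemannSiegelExpr

noncomputable section

/-- The theta function `θ(z) = ∑_{n ∈ ℤ} exp (-π n² z)`, for `Re z > 0`, written through Mathlib's
`jacobiTheta τ = ∑_{n ∈ ℤ} exp (π i n² τ)`. -/
def theta (z : ℂ) : ℂ := jacobiTheta (Complex.I * z)

/-- The entire function `s ↦ ∫_1^∞ x^{s/2} (θ(x) - 1)/2 dx/x`. -/
def thetaIntegral (s : ℂ) : ℂ :=
  ∫ x in Set.Ioi (1 : ℝ), (x : ℂ) ^ (s / 2) * ((theta (x : ℂ) - 1) / 2) / (x : ℂ)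

/-- The meromorphic function `Λ(s) = π^{-s/2} Γ(s/2) 𝓛(s)`
`= -1/s + ∫_1^∞ x^{s/2} (θ(x) - 1)/2 dx/x`, for `s ≠ 0`. -/
def Lam (s : ℂ) : ℂ := -1 / s + thetaIntegral s

/-- The entire function `s Λ(s)`, with its correct value `-1` at the removable point `s = 0`. -/
def sLam (s : ℂ) : ℂ := -1 + s * thetaIntegral s

theorem sLam_eq {s : ℂ} (hs : s ≠ 0) : sLam s = s * Lam s := by
  unfold sLam Lam
  field_simp

theorem sLam_zero : sLam 0 = -1 := by
  simp [sLam]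

/-- `b : ℤ → ℂ` enumerates the zeros of `s Λ(s)`, each repeated according to its multiplicity, in
the following way: `b 0` is real and all other `b n` are not, `b (-n)` is the conjugate of `b n`,
and `|b n| ≤ |b (n + 1)|` for `n ≥ 1`. -/
structure IsZeroEnumeration (b : ℤ → ℂ) : Prop where
  multiplicity : ∀ z : ℂ, {n : ℤ | b n = z}.encard = analyticOrderAt sLam z
  real_iff : ∀ n : ℤ, (b n).im = 0 ↔ n = 0
  conj : ∀ n : ℤ, b (-n) = (starRingEnd ℂ) (b n)
  ordered : ∀ n : ℤ, 1 ≤ n → ‖b n‖ ≤ ‖b (n + 1)‖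

/-- The point `1/2 + it` of the critical line. -/
def crit (t : ℝ) : ℂ := 1 / 2 + (t : ℂ) * Complex.I

/-- The Riemann-Siegel function `Z(t) = e^{iϑ(t)} ζ(1/2 + it)`, as a complex number. By the
definition of `ϑ`, `π^{-s/2} Γ(s/2) = |π^{-s/2} Γ(s/2)| e^{iϑ(t)}` for `s = 1/2 + it`; recall that
`Complex.Gammaℝ s = π^{-s/2} Γ(s/2)`. -/
def Z (t : ℝ) : ℂ :=
  Complex.Gammaℝ (crit t) / (‖Complex.Gammaℝ (crit t)‖ : ℂ) * riemannZeta (crit t)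

/-- `φ(t)` is the continuous determination of `arg Λ(1/2 + it)` that is close to `π/2` for large
positive `t`. -/
structure IsArgLam (φ : ℝ → ℝ) : Prop where
  continuous : Continuous φ
  ne_zero : ∀ t : ℝ, Lam (crit t) ≠ 0
  polar : ∀ t : ℝ, Lam (crit t) = (‖Lam (crit t)‖ : ℂ) * Complex.exp ((φ t : ℂ) * Complex.I)
  near : ∀ t : ℝ, 10 < t → |φ t - Real.pi / 2| < 0.19

/-- The general term `arg (1 - s/b_n) + Im (s/b_n)` of the series, with `s = 1/2 + it` and the
principal value of the argument. -/
def argTerm (b : ℤ → ℂ) (t : ℝ) (n : ℤ) : ℝ :=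
  Complex.arg (1 - crit t / b n) + (crit t / b n).im

/-- `-π/2 + α t + arctan 2t - ∑_{n ∈ ℤ} (arg (1 - s/b_n) + Im (s/b_n))`, `s = 1/2 + it`. -/
def bracket (α : ℝ) (b : ℤ → ℂ) (t : ℝ) : ℝ :=
  -(Real.pi / 2) + α * t + Real.arctan (2 * t) - ∑' n : ℤ, argTerm b t n

end

end RiemannSiegelExpr

namespace RiemannSiegelExpr

open Filter Topology Metric Set MeasureTheory

/-!
Summing `(θ(x) - 1) / 2 = ∑ exp (-π n² x)`, `n ≥ 1`, under the integral sign expresses the entire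
part of `Λ` as a sum of generalized exponential integrals `∫_1^∞ x^{s/2-1} e^{-cx} dx`, and
everything about `Λ` is read off from these.

*Product.* They give `|s Λ(s)| ≤ exp (3 (1 + |s|)^{3/2})`. An entire function `f` of growth exponent
less than `2` with `f(0) = 1` is `e^{f'(0) s}` times the canonical product of genus one over its
zeros: divide `f` by its zeros in a disc of radius `R`, take a logarithm of the quotient on that
disc, and let `R → ∞` in its Taylor expansion at `0`, whose quadratic remainder is
`O((|s| / R)² sup log|f|)`.

*Zeros.* On the real axis `s Λ(s) + 1 = s · thetaIntegral s` is nonpositive for `s ≤ 0` and strictly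
increasing for `s > 0`, so there is a single real zero, and it is simple. If there were finitely
many zeros, the product formula would make `s Λ(s)` of exponential type, whereas it exceeds every
`e^{Cσ}` along the positive axis. The other zeros therefore form infinitely many conjugate pairs.

*Critical line.* Integrating by parts, `|e^{-c} + i Im(s/2) ∫_1^∞ x^{s/2-1} e^{-cx} dx| ≤ e^{-c}`
when `Re s ≤ 2c`. Hence `Im Λ(s) > 0` in the part of the upper half plane with `Re s ≤ 6`, so that
`-Λ` avoids the negative real axis on the critical line, and its principal argument is `arg Λ - π`.
It also follows that the zeros have real part greater than `1`, which keeps `1 - s / b_n` off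
`(-∞, 0]`. The formula `π^{-s/2} Γ(s/2) ζ(s) = Λ(s) + Λ(1 - s)` makes `Z(t)` a positive multiple of
`Re Λ(1/2 + it) = |Λ| sin (π/2 - arg Λ)`. The product formula expresses `arg Λ` through the
arguments of its factors: both sides are continuous determinations of the same angle, and they agree
at `t = 0`, where the contributions of conjugate zeros cancel.
-/

/-! ### Zeros of entire functions -/

section Zeros

variable {ι : Type*} {f F : ℂ → ℂ} {b : ι → ℂ}

/-- The family `b` lists the zeros of `f`, each zero repeated according to its multiplicity. The
index type carries no order, so that families indexed by `ℤ` and by the zeros themselves are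
covered alike. -/
def IsZeroFamily (f : ℂ → ℂ) (b : ι → ℂ) : Prop :=
  ∀ z, {i | b i = z}.encard = analyticOrderAt f z

namespace IsZeroFamily

theorem card_filter_le [DecidableEq ℂ] (hb : IsZeroFamily f b) (T : Finset ι) (z : ℂ) :
    ((T.filter (b · = z)).card : ℕ∞) ≤ analyticOrderAt f z := by
  rw [← hb, ← Set.encard_coe_eq_coe_finsetCard]
  exact Set.encard_le_encard fun i hi => (Finset.mem_filter.1 hi).2

theorem exists_eq (hb : IsZeroFamily f b) (hf : Differentiable ℂ f) {z : ℂ} (hz : f z = 0) :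
    ∃ i, b i = z := by
  have hord : {i | b i = z}.encard ≠ 0 := by
    rw [hb]
    exact analyticOrderAt_ne_zero.2 ⟨hf.analyticAt z, hz⟩
  exact Set.nonempty_iff_ne_empty.2 (Set.encard_ne_zero.1 hord |>.ne_empty)

theorem apply_eq_zero (hb : IsZeroFamily f b) (i : ι) : f (b i) = 0 := by
  refine apply_eq_zero_of_analyticOrderAt_ne_zero ?_
  rw [← hb]
  exact Set.encard_ne_zero.2 ⟨i, rfl⟩

theorem ne_zero (hb : IsZeroFamily f b) (h0 : f 0 ≠ 0) (i : ι) : b i ≠ 0 := fun h =>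
  h0 (h ▸ hb.apply_eq_zero i)

end IsZeroFamily

theorem analyticOrderAt_one_sub_div {a : ℂ} (ha : a ≠ 0) (z : ℂ) :
    analyticOrderAt (fun s : ℂ => 1 - s / a) z = if a = z then 1 else 0 := by
  have hfac : (fun s : ℂ => 1 - s / a) = (fun _ : ℂ => -a⁻¹) * (fun s : ℂ => s - a) := by
    ext s
    simp only [Pi.mul_apply]
    field_simp
    ring
  have hconst : analyticOrderAt (fun _ : ℂ => -a⁻¹) z = 0 :=
    analyticOrderAt_eq_zero.2 (.inr (by simpa using ha))
  rw [hfac, analyticOrderAt_mul (by fun_prop) (by fun_prop), hconst, zero_add]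
  split_ifs with h
  · rw [← h, analyticOrderAt_id_sub_const_self]
  · exact analyticOrderAt_eq_zero.2 (.inr (sub_ne_zero.2 (Ne.symm h)))

theorem analyticOrderAt_prod_one_sub_div [DecidableEq ℂ] (hb : ∀ i, b i ≠ 0) (T : Finset ι)
    (z : ℂ) :
    analyticOrderAt (fun s : ℂ => ∏ i ∈ T, (1 - s / b i)) z = (T.filter (b · = z)).card := by
  classical
  induction T using Finset.induction_on with
  | empty => simp [analyticOrderAt_eq_zero]
  | insert a T ha ih =>
    have hprod : (fun s : ℂ => ∏ i ∈ insert a T, (1 - s / b i))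
        = (fun s : ℂ => 1 - s / b a) * (fun s : ℂ => ∏ i ∈ T, (1 - s / b i)) := by
      ext s
      simp [Finset.prod_insert ha]
    rw [hprod, analyticOrderAt_mul (by fun_prop) (by fun_prop), ih,
      analyticOrderAt_one_sub_div (hb a), Finset.filter_insert]
    split_ifs with h
    · rw [Finset.card_insert_of_notMem (by simp [ha]), add_comm, Nat.cast_add_one]
    · rw [zero_add]

theorem exists_eq_one_sub_div_mul (hF : Differentiable ℂ F) {a : ℂ} (ha : a ≠ 0) (h : F a = 0) :
    ∃ G : ℂ → ℂ, Differentiable ℂ G ∧ ∀ s, F s = (1 - s / a) * G s := by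
  have hslope : Differentiable ℂ (dslope F a) := by
    rw [← differentiableOn_univ] at hF ⊢
    exact (Complex.differentiableOn_dslope univ_mem).2 hF
  refine ⟨fun s => -a * dslope F a s, by fun_prop, fun s => ?_⟩
  have hmul := sub_smul_dslope F a s
  rw [h, sub_zero, smul_eq_mul] at hmul
  rw [← hmul]
  field_simp
  ring

theorem IsZeroFamily.exists_eq_prod_mul (hb : IsZeroFamily f b) (hf : Differentiable ℂ f)
    (h0 : f 0 ≠ 0) (T : Finset ι) :
    ∃ F : ℂ → ℂ, Differentiable ℂ F ∧ f = (fun s => ∏ i ∈ T, (1 - s / b i)) * F := by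
  classical
  have hb0 := hb.ne_zero h0
  induction T using Finset.induction_on with
  | empty => exact ⟨f, hf, by ext; simp⟩
  | insert a T ha ih =>
    obtain ⟨F, hF, hfF⟩ := ih
    have hord : 1 ≤ analyticOrderAt F (b a) := by
      have hle := hb.card_filter_le (insert a T) (b a)
      rw [hfF, analyticOrderAt_mul (by fun_prop) (hF.analyticAt _),
        analyticOrderAt_prod_one_sub_div hb0, Finset.filter_insert, if_pos rfl,
        Finset.card_insert_of_notMem (by simp [ha]), Nat.cast_add_one] at hle
      exact (ENat.add_le_add_iff_left (ENat.natCast_ne_top _)).1 hle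
    have hFa : F (b a) = 0 :=
      apply_eq_zero_of_analyticOrderAt_ne_zero (Order.one_le_iff_ne_zero.1 hord)
    obtain ⟨G, hG, hFG⟩ := exists_eq_one_sub_div_mul hF (hb0 a) hFa
    refine ⟨G, hG, ?_⟩
    rw [hfF]
    ext s
    simp only [Pi.mul_apply, Finset.prod_insert ha, hFG]
    ring

theorem norm_le_of_forall_norm_eq (hF : Differentiable ℂ F) {R M : ℝ} (hR : 0 < R)
    (hM : ∀ s, ‖s‖ = R → ‖F s‖ ≤ M) {z : ℂ} (hz : ‖z‖ ≤ R) : ‖F z‖ ≤ M := by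
  refine Complex.norm_le_of_forall_mem_frontier_norm_le (U := ball (0 : ℂ) R) isBounded_ball
    hF.diffContOnCl (fun s hs => hM s ?_) ?_
  · simpa [frontier_ball (0 : ℂ) hR.ne'] using hs
  · simpa [closure_ball (0 : ℂ) hR.ne'] using hz

theorem le_norm_one_sub_div {s a : ℂ} {k R : ℝ} (ha : a ≠ 0) (haR : ‖a‖ ≤ R) (hk : 0 ≤ k)
    (hs : ‖s‖ = (k + 1) * R) : k ≤ ‖1 - s / a‖ := by
  have hquot : k + 1 ≤ ‖s / a‖ := by
    rw [norm_div, hs, le_div_iff₀ (norm_pos_iff.2 ha)]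
    gcongr
  have htri := norm_sub_norm_le (s / a) 1
  rw [norm_one, norm_sub_rev] at htri
  linarith

theorem pow_card_mul_norm_le (hb : ∀ i, b i ≠ 0) (hF : Differentiable ℂ F) {T : Finset ι}
    {k R M : ℝ} (hk : 0 ≤ k) (hR : 0 < R) (hT : ∀ i ∈ T, ‖b i‖ ≤ R)
    (hM : ∀ s, ‖s‖ = (k + 1) * R → ‖(∏ i ∈ T, (1 - s / b i)) * F s‖ ≤ M) {z : ℂ}
    (hz : ‖z‖ ≤ (k + 1) * R) : k ^ T.card * ‖F z‖ ≤ M := by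
  have hnorm : ∀ s, ‖(k : ℂ) ^ T.card * F s‖ = k ^ T.card * ‖F s‖ := fun s => by
    rw [norm_mul, norm_pow, Complex.norm_of_nonneg hk]
  rw [← hnorm]
  refine norm_le_of_forall_norm_eq (hF.const_mul _) (by positivity) (fun s hs => ?_) hz
  have hprod : k ^ T.card ≤ ‖∏ i ∈ T, (1 - s / b i)‖ := by
    rw [norm_prod, ← Finset.prod_const]
    exact Finset.prod_le_prod (fun _ _ => hk) fun i hi =>
      le_norm_one_sub_div (hb i) (hT i hi) hk hs
  calc ‖(k : ℂ) ^ T.card * F s‖ = k ^ T.card * ‖F s‖ := hnorm s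
    _ ≤ ‖∏ i ∈ T, (1 - s / b i)‖ * ‖F s‖ := by gcongr
    _ = ‖(∏ i ∈ T, (1 - s / b i)) * F s‖ := (norm_mul _ _).symm
    _ ≤ M := hM s hs

namespace IsZeroFamily

theorem two_pow_card_mul_norm_le (hb : IsZeroFamily f b) (hf : Differentiable ℂ f)
    (h0 : f 0 ≠ 0) {R M : ℝ} (hR : 0 < R) (hM : ∀ s, ‖s‖ = 3 * R → ‖f s‖ ≤ M) {T : Finset ι}
    (hT : ∀ i ∈ T, ‖b i‖ ≤ R) : 2 ^ T.card * ‖f 0‖ ≤ M := by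
  obtain ⟨F, hF, rfl⟩ := hb.exists_eq_prod_mul hf h0 T
  have hle := pow_card_mul_norm_le (k := 2) (M := M) (z := 0) (hb.ne_zero h0) hF two_pos.le hR hT
    (fun s hs => hM s (by rw [hs]; ring)) (by rw [norm_zero]; positivity)
  simpa using hle

theorem finite_norm_le (hb : IsZeroFamily f b) (hf : Differentiable ℂ f) (h0 : f 0 ≠ 0) (R : ℝ) :
    {i | ‖b i‖ ≤ R}.Finite := by
  by_contra hinf
  have hinf' : {i | ‖b i‖ ≤ max R 1}.Infinite :=
    Set.Infinite.mono (fun i (hi : ‖b i‖ ≤ R) => hi.trans (le_max_left R 1)) hinf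
  obtain ⟨M, hM⟩ := (isCompact_closedBall (0 : ℂ) (3 * max R 1)).exists_bound_of_continuousOn
    hf.continuous.continuousOn
  obtain ⟨n, hn⟩ := pow_unbounded_of_one_lt (M / ‖f 0‖) one_lt_two
  obtain ⟨T, hT, rfl⟩ := hinf'.exists_subset_card_eq n
  have hle := hb.two_pow_card_mul_norm_le hf h0 (by positivity : 0 < max R 1)
    (fun s hs => hM s (by simp [hs])) (fun i hi => hT hi)
  rw [div_lt_iff₀ (norm_pos_iff.2 h0)] at hn
  linarith

theorem cofactor_ne_zero (hb : IsZeroFamily f b) (h0 : f 0 ≠ 0) {T : Finset ι}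
    (hF : Differentiable ℂ F) (hfF : f = (fun s => ∏ i ∈ T, (1 - s / b i)) * F) {z : ℂ}
    (hT : ∀ i, b i = z → i ∈ T) : F z ≠ 0 := by
  classical
  have hcard : analyticOrderAt f z = (T.filter (b · = z)).card := by
    rw [← hb, ← Set.encard_coe_eq_coe_finsetCard]
    congr 1
    ext i
    simpa using hT i
  have hord : ((T.filter (b · = z)).card : ℕ∞) + analyticOrderAt F z
      = (T.filter (b · = z)).card + 0 := by
    rw [← analyticOrderAt_prod_one_sub_div (hb.ne_zero h0),
      ← analyticOrderAt_mul (by fun_prop) (hF.analyticAt _), ← hfF, hcard, add_zero,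
      analyticOrderAt_prod_one_sub_div (hb.ne_zero h0)]
  refine fun hFz => analyticOrderAt_ne_zero.2 ⟨hF.analyticAt z, hFz⟩ ?_
  exact ENat.add_right_injective_of_ne_top (ENat.natCast_ne_top _) hord

end IsZeroFamily

end Zeros

/-! ### Hadamard factorization in genus one -/

section Hadamard

variable {ι : Type*} {f F : ℂ → ℂ} {b : ι → ℂ}

theorem exists_eqOn_exp_of_ne_zero {c : ℂ} {R : ℝ} (hR : 0 < R)
    (hF : DifferentiableOn ℂ F (ball c R)) (hne : ∀ z ∈ ball c R, F z ≠ 0) :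
    ∃ h : ℂ → ℂ, DifferentiableOn ℂ h (ball c R) ∧ h c = Complex.log (F c) ∧
      EqOn F (fun z => Complex.exp (h z)) (ball c R) := by
  have hc : c ∈ ball c R := mem_ball_self hR
  obtain ⟨h, hhc, hder⟩ :=
    ((hF.deriv isOpen_ball).div hF hne).isExactOn_ball.with_val_at c (Complex.log (F c))
  have hquot : ∀ w ∈ ball c R, HasDerivAt (fun w => F w * Complex.exp (-h w)) 0 w := by
    intro w hw
    have hFw := (hF.differentiableAt (isOpen_ball.mem_nhds hw)).hasDerivAt
    refine (hFw.mul (hder w hw).neg.cexp).congr_deriv ?_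
    have := hne w hw
    simp only [Pi.div_apply]
    field_simp
    ring
  refine ⟨h, fun z hz => (hder z hz).differentiableAt.differentiableWithinAt, hhc, fun z hz => ?_⟩
  have hconst := isOpen_ball.is_const_of_deriv_eq_zero (convex_ball c R).isPreconnected
    (fun w hw => (hquot w hw).differentiableAt.differentiableWithinAt)
    (fun w hw => (hquot w hw).deriv) hz hc
  simp only [hhc, Complex.exp_neg, Complex.exp_log (hne c hc)] at hconst
  rwa [mul_inv_cancel₀ (hne c hc), mul_inv_eq_one₀ (Complex.exp_ne_zero _)] at hconst

theorem norm_sub_sub_deriv_mul_le {h : ℂ → ℂ} {c : ℂ} {R M : ℝ}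
    (hd : DifferentiableOn ℂ h (ball c R)) (hM : ∀ w ∈ ball c R, ‖h w - h c‖ ≤ M) {z : ℂ}
    (hz : z ∈ ball c R) : ‖h z - h c - deriv h c * (z - c)‖ ≤ 2 * M * (‖z - c‖ / R) ^ 2 := by
  have hR : 0 < R := nonempty_ball.1 ⟨z, hz⟩
  have hder : ‖deriv h c‖ ≤ M / R :=
    Complex.norm_deriv_le_div_of_mapsTo_ball hd (fun w hw => by simpa [dist_eq_norm] using hM w hw)
      hR
  have hmaps : ∀ w ∈ ball c R, ‖h w - h c - deriv h c * (w - c)‖ ≤ 2 * M := fun w hw => by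
    calc ‖h w - h c - deriv h c * (w - c)‖ ≤ ‖h w - h c‖ + ‖deriv h c‖ * ‖w - c‖ := by
          rw [← norm_mul]
          exact norm_sub_le _ _
      _ ≤ M + M / R * R := by
          gcongr
          · exact hM w hw
          · exact (norm_nonneg _).trans hder
          · exact (mem_ball_iff_norm.1 hw).le
      _ = 2 * M := by
          field_simp
          ring
  have hlittle : (fun w => h w - h c - deriv h c * (w - c)) =o[𝓝 c] fun w => ‖w - c‖ ^ 1 := by
    have hc := (hd.differentiableAt (isOpen_ball.mem_nhds (mem_ball_self hR))).hasDerivAt.isLittleO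
    simpa [mul_comm] using hc.norm_right
  have hschwarz := Complex.dist_le_mul_div_pow_of_mapsTo_ball_of_isLittleO (n := 1) (R₂ := 2 * M)
    (f := fun w => h w - h c - deriv h c * (w - c)) (c := c) (by fun_prop)
    (fun w hw => by simpa using hmaps w hw) (by simpa using hlittle) hz
  simpa [dist_eq_norm] using hschwarz

theorem exists_eq_exp_deriv_mul_add {R M : ℝ} (hM : 0 < M)
    (hF : DifferentiableOn ℂ F (ball 0 R)) (h0 : F 0 = 1) (hne : ∀ z ∈ ball (0 : ℂ) R, F z ≠ 0)
    (hFM : ∀ z ∈ ball (0 : ℂ) R, ‖F z‖ ≤ Real.exp M) {z : ℂ} (hz : ‖z‖ < R / 2) :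
    ∃ δ : ℂ, ‖δ‖ ≤ 4 * M * (‖z‖ / (R / 2)) ^ 2 ∧ F z = Complex.exp (deriv F 0 * z + δ) := by
  have hR2 : 0 < R / 2 := (norm_nonneg z).trans_lt hz
  have hR : 0 < R := by linarith
  have hsub : ball (0 : ℂ) (R / 2) ⊆ ball 0 R := ball_subset_ball (by linarith)
  obtain ⟨h, hd, hh0, hexp⟩ := exists_eqOn_exp_of_ne_zero hR hF hne
  rw [h0, Complex.log_one] at hh0
  have hderiv : deriv h 0 = deriv F 0 := by
    have hmem : ball (0 : ℂ) R ∈ 𝓝 0 := ball_mem_nhds 0 hR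
    rw [(hexp.eventuallyEq_of_mem hmem).deriv_eq,
      ((hd.differentiableAt hmem).hasDerivAt.cexp).deriv, hh0, Complex.exp_zero, one_mul]
  have hre : MapsTo h (ball 0 R) {w | w.re ≤ M} := fun w hw => by
    have := hFM w hw
    rwa [hexp hw, Complex.norm_exp, Real.exp_le_exp] at this
  have hbound : ∀ w ∈ ball (0 : ℂ) (R / 2), ‖h w - h 0‖ ≤ 2 * M := fun w hw => by
    have hw' : ‖w‖ < R / 2 := mem_ball_zero_iff.1 hw
    rw [hh0, sub_zero]
    refine (Complex.borelCaratheodory_zero hM hd hre hR (hsub hw) hh0).trans ?_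
    rw [div_le_iff₀ (by linarith)]
    gcongr
    linarith
  have hz' : z ∈ ball (0 : ℂ) (R / 2) := mem_ball_zero_iff.2 hz
  have hrem := norm_sub_sub_deriv_mul_le (hd.mono hsub) hbound hz'
  simp only [hh0, sub_zero, hderiv] at hrem
  refine ⟨h z - deriv F 0 * z, hrem.trans (by linarith), ?_⟩
  rw [add_sub_cancel]
  exact hexp (hsub hz')

theorem hasDerivAt_prod_one_sub_div (b : ι → ℂ) (T : Finset ι) :
    HasDerivAt (fun s : ℂ => ∏ i ∈ T, (1 - s / b i)) (-∑ i ∈ T, 1 / b i) 0 := by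
  classical
  refine (HasDerivAt.fun_finsetProd fun i _ =>
    ((hasDerivAt_id (0 : ℂ)).div_const (b i)).const_sub 1).congr_deriv ?_
  simp

theorem IsZeroFamily.exists_prod_eq_mul_exp (hb : IsZeroFamily f b) (hf : Differentiable ℂ f)
    (h0 : f 0 = 1) {R M : ℝ} (hM : 0 < M) (hfM : ∀ s, ‖s‖ = 2 * R → ‖f s‖ ≤ Real.exp M)
    {T : Finset ι} (hT : ∀ i, i ∈ T ↔ ‖b i‖ ≤ R) {s : ℂ} (hs : ‖s‖ < R / 2) :
    ∃ δ : ℂ, ‖δ‖ ≤ 4 * M * (‖s‖ / (R / 2)) ^ 2 ∧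
      ∏ i ∈ T, (1 - s / b i) * Complex.exp (s / b i)
        = f s * Complex.exp (-(deriv f 0 * s)) * Complex.exp (-δ) := by
  have h0' : f 0 ≠ 0 := by simp [h0]
  have hR : 0 < R := by linarith [norm_nonneg s]
  obtain ⟨F, hF, hfF⟩ := hb.exists_eq_prod_mul hf h0' T
  have hF0 : F 0 = 1 := by simpa [h0] using (congrFun hfF 0).symm
  have hne : ∀ z ∈ ball (0 : ℂ) R, F z ≠ 0 := fun z hz =>
    hb.cofactor_ne_zero h0' hF hfF fun i hi => (hT i).2 (hi ▸ (mem_ball_zero_iff.1 hz).le)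
  have hFM : ∀ z ∈ ball (0 : ℂ) R, ‖F z‖ ≤ Real.exp M := fun z hz => by
    have hle := pow_card_mul_norm_le (k := 1) (M := Real.exp M) (z := z) (hb.ne_zero h0') hF
      zero_le_one hR (fun i hi => (hT i).1 hi)
      (fun w hw => by simpa [hfF] using hfM w (by rw [hw]; ring))
      (by linarith [mem_ball_zero_iff.1 hz])
    simpa using hle
  obtain ⟨δ, hδ, hFδ⟩ := exists_eq_exp_deriv_mul_add hM hF.differentiableOn hF0 hne hFM hs
  have hderiv : deriv f 0 = deriv F 0 - ∑ i ∈ T, 1 / b i := by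
    have hmul := (hasDerivAt_prod_one_sub_div b T).mul (hF 0).hasDerivAt
    rw [← hfF] at hmul
    rw [hmul.deriv]
    simp only [one_div, hF0, mul_one, zero_div, sub_zero, Finset.prod_const_one, one_mul]
    ring
  refine ⟨δ, hδ, ?_⟩
  have hsum : ∑ i ∈ T, s / b i = (∑ i ∈ T, 1 / b i) * s := by
    rw [Finset.sum_mul]
    exact Finset.sum_congr rfl fun i _ => by ring
  rw [Finset.prod_mul_distrib, ← Complex.exp_sum, hsum, congrFun hfF s, Pi.mul_apply, hFδ, hderiv,
    mul_assoc, mul_assoc, ← Complex.exp_add, ← Complex.exp_add]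
  congr 2
  ring

theorem norm_one_sub_mul_exp_sub_one_le {w : ℂ} (hw : ‖w‖ ≤ 1) :
    ‖(1 - w) * Complex.exp w - 1‖ ≤ 3 * ‖w‖ ^ 2 := by
  calc ‖(1 - w) * Complex.exp w - 1‖ = ‖(1 - w) * (Complex.exp w - 1 - w) - w ^ 2‖ := by ring_nf
    _ ≤ ‖1 - w‖ * ‖Complex.exp w - 1 - w‖ + ‖w‖ ^ 2 := by
        rw [← norm_mul, ← norm_pow]
        exact norm_sub_le _ _
    _ ≤ 2 * ‖w‖ ^ 2 + ‖w‖ ^ 2 := by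
        gcongr
        · exact (norm_sub_le _ _).trans (by rw [norm_one]; linarith)
        · exact Complex.norm_exp_sub_one_sub_id_le hw
    _ = 3 * ‖w‖ ^ 2 := by ring

theorem multipliable_one_sub_mul_exp {w : ι → ℂ} (hw : Summable fun i => ‖w i‖ ^ 2) :
    Multipliable fun i => (1 - w i) * Complex.exp (w i) := by
  have hsum : Summable fun i => (1 - w i) * Complex.exp (w i) - 1 := by
    refine .of_norm_bounded_eventually (hw.mul_left 3) ?_
    have hsmall := hw.tendsto_cofinite_zero.eventually (gt_mem_nhds zero_lt_one)
    filter_upwards [hsmall] with i hi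
    exact norm_one_sub_mul_exp_sub_one_le (by nlinarith)
  simpa using multipliable_one_add_of_summable hsum.norm

theorem IsZeroFamily.hasProd_one_sub_div_mul_exp (hb : IsZeroFamily f b) (hf : Differentiable ℂ f)
    (h0 : f 0 = 1) (hsum : Summable fun i => (‖b i‖ ^ 2)⁻¹) {G : ℝ → ℝ}
    (hG : ∀ s, ‖f s‖ ≤ Real.exp (G ‖s‖)) (hGpos : ∀ r, 0 ≤ r → 0 < G r)
    (hGlim : Tendsto (fun r => G r / r ^ 2) atTop (𝓝 0)) (s : ℂ) :
    HasProd (fun i => (1 - s / b i) * Complex.exp (s / b i))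
      (f s * Complex.exp (-(deriv f 0 * s))) := by
  have hfin := hb.finite_norm_le hf (by simp [h0])
  have hsq : Summable fun i => ‖s / b i‖ ^ 2 :=
    (hsum.mul_left (‖s‖ ^ 2)).congr fun i => by rw [norm_div, div_pow, div_eq_mul_inv]
  have hprod := (multipliable_one_sub_mul_exp hsq).hasProd
  have hdiscs : Tendsto (fun R => (hfin R).toFinset) atTop atTop :=
    tendsto_atTop_finset_of_monotone
      (fun R R' hRR' => Set.Finite.toFinset_mono fun i (hi : ‖b i‖ ≤ R) => hi.trans hRR')
      (fun i => ⟨‖b i‖, by simp⟩)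
  have hexists : ∀ᶠ R in atTop, ∃ δ : ℂ, ‖δ‖ ≤ 4 * G (2 * R) * (‖s‖ / (R / 2)) ^ 2 ∧
      ∏ i ∈ (hfin R).toFinset, (1 - s / b i) * Complex.exp (s / b i)
        = f s * Complex.exp (-(deriv f 0 * s)) * Complex.exp (-δ) := by
    filter_upwards [eventually_gt_atTop (2 * ‖s‖)] with R hR
    have := norm_nonneg s
    exact hb.exists_prod_eq_mul_exp hf h0 (hGpos _ (by linarith)) (fun w hw => hw ▸ hG w)
      (fun i => by simp) (by linarith)
  obtain ⟨δ, hδ⟩ := hexists.choice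
  have hδ0 : Tendsto δ atTop (𝓝 0) := by
    refine squeeze_zero_norm' (hδ.mono fun R h => h.1) ?_
    have hlim := (hGlim.comp (tendsto_id.const_mul_atTop two_pos)).const_mul (64 * ‖s‖ ^ 2)
    rw [mul_zero] at hlim
    refine hlim.congr' ?_
    filter_upwards [eventually_gt_atTop 0] with R hR
    simp only [Function.comp_apply, id]
    field_simp
    ring
  have hlimit := ((Complex.continuous_exp.tendsto _).comp hδ0.neg).const_mul
    (f s * Complex.exp (-(deriv f 0 * s)))
  rw [neg_zero, Complex.exp_zero, mul_one] at hlimit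
  rwa [← tendsto_nhds_unique (hprod.comp hdiscs) (hlimit.congr' (hδ.mono fun R h => h.2.symm))]

theorem summable_rpow_neg_of_card_le {r : ι → ℝ} {C ρ σ : ℝ} (hr : ∀ i, 1 ≤ r i) (hρ : ρ < σ)
    (hcard : ∀ R, 1 ≤ R → ∀ T : Finset ι, (∀ i ∈ T, r i ≤ R) → (T.card : ℝ) ≤ C * R ^ ρ)
    (hσ : 0 ≤ σ) : Summable fun i => r i ^ (-σ) := by
  choose k hk hk' using fun i => exists_nat_pow_near (hr i) one_lt_two
  set q : ℝ := 2 ^ (ρ - σ)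
  have hq : q < 1 := Real.rpow_lt_one_of_one_lt_of_neg one_lt_two (by linarith)
  have hgeom := (summable_geometric_of_lt_one (by positivity) hq).mul_left (C * 2 ^ ρ)
  have hC : 0 ≤ C := by simpa using hcard 1 le_rfl ∅ (by simp)
  have hterm : ∀ i, r i ^ (-σ) ≤ ((2 : ℝ) ^ k i) ^ (-σ) := fun i =>
    Real.rpow_le_rpow_of_nonpos (by positivity) (hk i) (by linarith)
  have hshell : ∀ (T : Finset ι) (m : ℕ),
      ∑ i ∈ T with k i = m, r i ^ (-σ) ≤ C * 2 ^ ρ * q ^ m := fun T m => by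
    calc ∑ i ∈ T with k i = m, r i ^ (-σ)
        ≤ (T.filter (k · = m)).card • ((2 : ℝ) ^ m) ^ (-σ) :=
          Finset.sum_le_card_nsmul _ _ _ fun i hi => (Finset.mem_filter.1 hi).2 ▸ hterm i
      _ ≤ C * ((2 : ℝ) ^ (m + 1)) ^ ρ * ((2 : ℝ) ^ m) ^ (-σ) := by
          rw [nsmul_eq_mul]
          gcongr
          exact hcard _ (one_le_pow₀ one_le_two) _ fun i hi =>
            (Finset.mem_filter.1 hi).2 ▸ (hk' i).le
      _ = C * 2 ^ ρ * q ^ m := by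
          rw [pow_succ, Real.mul_rpow (by positivity) two_pos.le, ← Real.rpow_natCast q,
            ← Real.rpow_mul two_pos.le, mul_comm (ρ - σ), Real.rpow_mul two_pos.le,
            Real.rpow_natCast, sub_eq_add_neg, Real.rpow_add (by positivity)]
          ring
  refine summable_of_sum_le (c := ∑' m, C * 2 ^ ρ * q ^ m)
    (fun i => Real.rpow_nonneg (zero_le_one.trans (hr i)) _) fun T => ?_
  calc ∑ i ∈ T, r i ^ (-σ) = ∑ m ∈ T.image k, ∑ i ∈ T with k i = m, r i ^ (-σ) :=
        (Finset.sum_fiberwise_of_maps_to (fun i hi => Finset.mem_image_of_mem k hi) _).symm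
    _ ≤ ∑ m ∈ T.image k, C * 2 ^ ρ * q ^ m := Finset.sum_le_sum fun m _ => hshell T m
    _ ≤ ∑' m, C * 2 ^ ρ * q ^ m := hgeom.sum_le_tsum _ fun m _ => by positivity

theorem IsZeroFamily.card_le_of_norm_le_exp_rpow (hb : IsZeroFamily f b)
    (hf : Differentiable ℂ f) (h0 : f 0 = 1) {C ρ : ℝ} (hC : 0 ≤ C) (hρ : 0 ≤ ρ)
    (hgrowth : ∀ s, ‖f s‖ ≤ Real.exp (C * (1 + ‖s‖) ^ ρ)) {R : ℝ} (hR : 1 ≤ R) {T : Finset ι}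
    (hT : ∀ i ∈ T, ‖b i‖ ≤ R) : (T.card : ℝ) ≤ 2 * C * 4 ^ ρ * R ^ ρ := by
  have hpow : (2 : ℝ) ^ T.card ≤ Real.exp (C * (4 * R) ^ ρ) := by
    have hle := hb.two_pow_card_mul_norm_le hf (by simp [h0]) (M := Real.exp (C * (4 * R) ^ ρ))
      (zero_lt_one.trans_le hR) (fun s hs => (hgrowth s).trans ?_) hT
    · simpa [h0] using hle
    · gcongr
      linarith
  have hlog := Real.log_le_log (by positivity) hpow
  rw [Real.log_pow, Real.log_exp, Real.mul_rpow (by norm_num) (by linarith)] at hlog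
  nlinarith [Real.log_two_gt_d9, (Nat.cast_nonneg T.card : (0 : ℝ) ≤ _)]

theorem IsZeroFamily.summable_inv_norm_sq (hb : IsZeroFamily f b) (hf : Differentiable ℂ f)
    (h0 : f 0 = 1) {C ρ : ℝ} (hC : 0 ≤ C) (hρ : 0 ≤ ρ) (hρ2 : ρ < 2)
    (hgrowth : ∀ s, ‖f s‖ ≤ Real.exp (C * (1 + ‖s‖) ^ ρ)) :
    Summable fun i => (‖b i‖ ^ 2)⁻¹ := by
  have hmax : Summable fun i => max 1 ‖b i‖ ^ (-2 : ℝ) :=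
    summable_rpow_neg_of_card_le (C := 2 * C * 4 ^ ρ) (fun i => le_max_left 1 _) hρ2
      (fun R hR T hT => hb.card_le_of_norm_le_exp_rpow hf h0 hC hρ hgrowth hR fun i hi =>
        (le_max_right 1 _).trans (hT i hi)) two_pos.le
  refine hmax.congr_cofinite ?_
  filter_upwards [(hb.finite_norm_le hf (by simp [h0]) 1).compl_mem_cofinite] with i hi
  have hlt : 1 < ‖b i‖ := not_le.1 hi
  rw [max_eq_right hlt.le, Real.rpow_neg (norm_nonneg _), Real.rpow_two]

theorem tendsto_one_add_rpow_div_sq {ρ : ℝ} (hρ : 0 ≤ ρ) (hρ2 : ρ < 2) :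
    Tendsto (fun r : ℝ => (1 + r) ^ ρ / r ^ 2) atTop (𝓝 0) := by
  have hlim := (tendsto_rpow_neg_atTop (sub_pos.2 hρ2)).const_mul ((2 : ℝ) ^ ρ)
  rw [mul_zero] at hlim
  refine squeeze_zero' ?_ ?_ hlim
  · filter_upwards [eventually_ge_atTop 0] with r hr
    positivity
  · filter_upwards [eventually_ge_atTop 1] with r hr
    have hr0 : 0 < r := by linarith
    rw [neg_sub, Real.rpow_sub hr0, Real.rpow_two, ← mul_div_assoc,
      ← Real.mul_rpow two_pos.le hr0.le]
    gcongr
    linarith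

theorem IsZeroFamily.hasProd_of_norm_le_exp_rpow (hb : IsZeroFamily f b)
    (hf : Differentiable ℂ f) (h0 : f 0 = 1) {C ρ : ℝ} (hC : 0 < C) (hρ : 0 ≤ ρ) (hρ2 : ρ < 2)
    (hgrowth : ∀ s, ‖f s‖ ≤ Real.exp (C * (1 + ‖s‖) ^ ρ)) (s : ℂ) :
    HasProd (fun i => (1 - s / b i) * Complex.exp (s / b i))
      (f s * Complex.exp (-(deriv f 0 * s))) := by
  refine hb.hasProd_one_sub_div_mul_exp hf h0
    (hb.summable_inv_norm_sq hf h0 hC.le hρ hρ2 hgrowth) (G := fun r => C * (1 + r) ^ ρ) hgrowth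
    (fun r hr => by positivity) ?_ s
  simpa [mul_div_assoc] using (tendsto_one_add_rpow_div_sq hρ hρ2).const_mul C

end Hadamard

/-! ### Generalized exponential integrals -/

section ExpIntegral

/-- The integral `∫_1^∞ x^{z-1} e^{-cx} dx`, that is, the generalized exponential integral
`E_{1-z}(c)`, or `c^{-z} Γ(z, c)` in terms of the upper incomplete Gamma function. -/
noncomputable def expIntegral (c : ℝ) (z : ℂ) : ℂ :=
  ∫ x in Ioi (1 : ℝ), (x : ℂ) ^ (z - 1) * (Real.exp (-c * x) : ℂ)

variable {c : ℝ}

theorem norm_cpow_mul_exp (c : ℝ) (z : ℂ) {x : ℝ} (hx : x ∈ Ioi (1 : ℝ)) :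
    ‖(x : ℂ) ^ (z - 1) * (Real.exp (-c * x) : ℂ)‖ = x ^ (z.re - 1) * Real.exp (-c * x) := by
  have hx0 : 0 < x := one_pos.trans hx
  rw [norm_mul, Complex.norm_cpow_eq_rpow_re_of_pos hx0, Complex.norm_of_nonneg (Real.exp_pos _).le,
    Complex.sub_re, Complex.one_re]

theorem integrableOn_rpow_mul_exp (a : ℝ) (hc : 0 < c) :
    IntegrableOn (fun x : ℝ => x ^ a * Real.exp (-c * x)) (Ioi 1) := by
  refine integrable_of_isBigO_exp_neg (half_pos hc) (ContinuousOn.mul (fun x hx => ?_) ?_) ?_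
  · have hx0 : x ≠ 0 := (one_pos.trans_le hx).ne'
    exact (Real.continuousAt_rpow_const x a (.inl hx0)).continuousWithinAt
  · fun_prop
  · refine ((isLittleO_rpow_exp_pos_mul_atTop a (half_pos hc)).isBigO.mul
      (Asymptotics.isBigO_refl (fun x : ℝ => Real.exp (-c * x)) atTop)).congr_right fun x => ?_
    rw [← Real.exp_add]
    ring_nf

theorem integrableOn_cpow_mul_exp (z : ℂ) (hc : 0 < c) :
    IntegrableOn (fun x : ℝ => (x : ℂ) ^ (z - 1) * (Real.exp (-c * x) : ℂ)) (Ioi 1) := by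
  refine (integrableOn_rpow_mul_exp (z.re - 1) hc).mono' ?_ ?_
  · refine ContinuousOn.aestronglyMeasurable (ContinuousOn.mul (fun x hx => ?_) ?_)
      measurableSet_Ioi
    · have hx0 : 0 < x := one_pos.trans hx
      exact ((continuousAt_cpow_const (.inl hx0)).comp
        Complex.continuous_ofReal.continuousAt).continuousWithinAt
    · fun_prop
  · filter_upwards [ae_restrict_mem measurableSet_Ioi] with x hx
    exact (norm_cpow_mul_exp c z hx).le

theorem expIntegral_ofReal (c σ : ℝ) :
    expIntegral c σ = (∫ x in Ioi (1 : ℝ), x ^ (σ - 1) * Real.exp (-c * x) : ℝ) := by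
  rw [expIntegral, ← integral_complex_ofReal]
  refine setIntegral_congr_fun measurableSet_Ioi fun x hx => ?_
  have hx0 : 0 ≤ x := (one_pos.trans hx).le
  rw [Complex.ofReal_mul, Complex.ofReal_cpow hx0, Complex.ofReal_sub, Complex.ofReal_one]

theorem integral_norm_cpow_mul_exp (c : ℝ) (z : ℂ) :
    ∫ x in Ioi (1 : ℝ), ‖(x : ℂ) ^ (z - 1) * (Real.exp (-c * x) : ℂ)‖
      = (expIntegral c z.re).re := by
  rw [expIntegral_ofReal, Complex.ofReal_re]
  exact setIntegral_congr_fun measurableSet_Ioi fun x hx => norm_cpow_mul_exp c z hx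

theorem norm_expIntegral_le (c : ℝ) (z : ℂ) : ‖expIntegral c z‖ ≤ (expIntegral c z.re).re :=
  (norm_integral_le_integral_norm _).trans (integral_norm_cpow_mul_exp c z).le

theorem expIntegral_conj (c : ℝ) (z : ℂ) :
    expIntegral c (starRingEnd ℂ z) = starRingEnd ℂ (expIntegral c z) := by
  rw [expIntegral, expIntegral, ← integral_conj]
  refine setIntegral_congr_fun measurableSet_Ioi fun x hx => ?_
  have harg : (x : ℂ).arg ≠ Real.pi := by
    rw [Complex.arg_ofReal_of_nonneg (one_pos.trans hx).le]
    exact Real.pi_ne_zero.symm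
  have hz : starRingEnd ℂ z - 1 = starRingEnd ℂ (z - 1) := by rw [map_sub, map_one]
  simp only [map_mul, Complex.conj_ofReal]
  rw [hz, Complex.cpow_conj _ _ harg, Complex.conj_ofReal]

theorem expIntegral_re_nonneg (c σ : ℝ) : 0 ≤ (expIntegral c σ).re := by
  rw [expIntegral_ofReal, Complex.ofReal_re]
  exact setIntegral_nonneg measurableSet_Ioi fun x (hx : 1 < x) => by positivity

theorem expIntegral_re_mono (hc : 0 < c) : Monotone fun σ : ℝ => (expIntegral c σ).re := by
  intro σ σ' hσ
  simp only [expIntegral_ofReal, Complex.ofReal_re]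
  refine setIntegral_mono_on (integrableOn_rpow_mul_exp _ hc) (integrableOn_rpow_mul_exp _ hc)
    measurableSet_Ioi fun x (hx : 1 < x) => ?_
  gcongr
  exact hx.le

theorem expIntegral_re_le_exp_mul {d : ℝ} (hd : 0 < d) (hdc : d ≤ c) (σ : ℝ) :
    (expIntegral c σ).re ≤ Real.exp (d - c) * (expIntegral d σ).re := by
  simp only [expIntegral_ofReal, Complex.ofReal_re]
  rw [← integral_const_mul]
  refine setIntegral_mono_on (integrableOn_rpow_mul_exp _ (hd.trans_le hdc))
    ((integrableOn_rpow_mul_exp _ hd).const_mul _) measurableSet_Ioi fun x (hx : 1 < x) => ?_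
  rw [mul_left_comm, ← Real.exp_add]
  gcongr
  nlinarith

theorem hasDerivAt_cpow_mul_exp (c : ℝ) (z : ℂ) {x : ℝ} (hx : 0 < x) :
    HasDerivAt (fun x : ℝ => (x : ℂ) ^ z * (Real.exp (-c * x) : ℂ))
      (z * ((x : ℂ) ^ (z - 1) * (Real.exp (-c * x) : ℂ))
        - c * ((x : ℂ) ^ (z + 1 - 1) * (Real.exp (-c * x) : ℂ))) x := by
  have hpow : HasDerivAt (fun x : ℝ => (x : ℂ) ^ z) (z * (x : ℂ) ^ (z - 1) * 1) x :=
    ((hasDerivAt_id (x : ℂ)).cpow_const (.inl hx)).comp_ofReal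
  have hexp := ((hasDerivAt_id x).const_mul (-c)).exp.ofReal_comp
  refine (hpow.mul hexp).congr_deriv ?_
  rw [add_sub_cancel_right]
  push_cast [id]
  ring

theorem tendsto_cpow_mul_exp (z : ℂ) (hc : 0 < c) :
    Tendsto (fun x : ℝ => (x : ℂ) ^ z * (Real.exp (-c * x) : ℂ)) atTop (𝓝 0) := by
  rw [tendsto_zero_iff_norm_tendsto_zero]
  refine (tendsto_rpow_mul_exp_neg_mul_atTop_nhds_zero z.re c hc).congr' ?_
  filter_upwards [eventually_gt_atTop 0] with x hx
  rw [norm_mul, Complex.norm_cpow_eq_rpow_re_of_pos hx, Complex.norm_of_nonneg (Real.exp_pos _).le]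

theorem mul_expIntegral_add_exp (z : ℂ) (hc : 0 < c) :
    z * expIntegral c z + Real.exp (-c) = c * expIntegral c (z + 1) := by
  have hint (w : ℂ) := integrableOn_cpow_mul_exp w hc
  have hparts := integral_Ioi_of_hasDerivAt_of_tendsto
    (hasDerivAt_cpow_mul_exp c z one_pos).continuousAt.continuousWithinAt
    (fun x (hx : 1 < x) => hasDerivAt_cpow_mul_exp c z (one_pos.trans hx))
    (((hint z).const_mul z).sub ((hint (z + 1)).const_mul (c : ℂ))) (tendsto_cpow_mul_exp z hc)
  rw [integral_sub ((hint z).const_mul z) ((hint (z + 1)).const_mul (c : ℂ)), integral_const_mul,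
    integral_const_mul, Complex.ofReal_one, Complex.one_cpow, mul_one, one_mul] at hparts
  rw [expIntegral, expIntegral]
  linear_combination hparts

theorem expIntegral_one (hc : 0 < c) : expIntegral c 1 = (Real.exp (-c) / c : ℝ) := by
  have hrec := mul_expIntegral_add_exp 0 hc
  rw [zero_mul, zero_add, zero_add] at hrec
  rw [Complex.ofReal_div, hrec, mul_div_cancel_left₀ _ (Complex.ofReal_ne_zero.2 hc.ne')]

theorem I_mul_im_mul_expIntegral_add_exp (z : ℂ) (hc : 0 < c) :
    Complex.I * z.im * expIntegral c z + Real.exp (-c)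
      = ∫ x in Ioi (1 : ℝ), ((c * x - z.re : ℝ) : ℂ) *
          ((x : ℂ) ^ (z - 1) * (Real.exp (-c * x) : ℂ)) := by
  have hint (w : ℂ) := integrableOn_cpow_mul_exp w hc
  have hrec := mul_expIntegral_add_exp z hc
  nth_rewrite 1 [← Complex.re_add_im z] at hrec
  calc Complex.I * z.im * expIntegral c z + Real.exp (-c)
      = c * expIntegral c (z + 1) - z.re * expIntegral c z := by linear_combination hrec
    _ = ∫ x in Ioi (1 : ℝ), (c * ((x : ℂ) ^ (z + 1 - 1) * (Real.exp (-c * x) : ℂ))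
          - z.re * ((x : ℂ) ^ (z - 1) * (Real.exp (-c * x) : ℂ))) := by
        rw [integral_sub ((hint (z + 1)).const_mul _) ((hint z).const_mul _), integral_const_mul,
          integral_const_mul, expIntegral, expIntegral]
    _ = _ := by
        refine setIntegral_congr_fun measurableSet_Ioi fun x hx => ?_
        have hx0 : (x : ℂ) ≠ 0 := Complex.ofReal_ne_zero.2 (one_pos.trans hx).ne'
        have hpow := Complex.cpow_add (z - 1) 1 hx0
        rw [sub_add_cancel, Complex.cpow_one] at hpow
        simp only [add_sub_cancel_right, hpow]
        push_cast
        ring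

/-- Integrating by parts, the left-hand side is the norm of the integral of
`(c - σ/x) x^σ e^{-cx}` against the phase `x^{iτ}`, where `z = σ + iτ`. The weight is nonnegative
for `σ ≤ c`, and its own integral, the case `τ = 0`, is `e^{-c}`. -/
theorem norm_I_mul_im_mul_expIntegral_add_exp_le {z : ℂ} (hc : 0 < c) (hz : z.re ≤ c) :
    ‖Complex.I * z.im * expIntegral c z + Real.exp (-c)‖ ≤ Real.exp (-c) := by
  have hreal := I_mul_im_mul_expIntegral_add_exp (z.re : ℂ) hc
  rw [Complex.ofReal_im, Complex.ofReal_zero, mul_zero, zero_mul, zero_add, Complex.ofReal_re]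
    at hreal
  rw [I_mul_im_mul_expIntegral_add_exp z hc]
  refine (norm_integral_le_integral_norm _).trans_eq ?_
  rw [← Complex.ofReal_inj, hreal, ← integral_complex_ofReal]
  refine setIntegral_congr_fun measurableSet_Ioi fun x (hx : 1 < x) => ?_
  have hweight : 0 ≤ c * x - z.re := by nlinarith
  have hx0 : 0 ≤ x := (one_pos.trans hx).le
  simp only [norm_mul (Complex.ofReal _), Complex.norm_of_nonneg hweight, norm_cpow_mul_exp c z hx]
  rw [← Complex.ofReal_one, ← Complex.ofReal_sub, ← Complex.ofReal_cpow hx0, ← Complex.ofReal_mul,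
    ← Complex.ofReal_mul]

theorem rpow_mul_exp_div_le_expIntegral_re (hc : 0 < c) {r σ : ℝ} (hr : 1 ≤ r) (hσ : 1 ≤ σ) :
    r ^ (σ - 1) * (Real.exp (-c * r) / c) ≤ (expIntegral c σ).re := by
  rw [expIntegral_ofReal, Complex.ofReal_re]
  have hint := integrableOn_rpow_mul_exp (σ - 1) hc
  have hsub : Ioi r ⊆ Ioi 1 := Ioi_subset_Ioi hr
  calc r ^ (σ - 1) * (Real.exp (-c * r) / c)
      = ∫ x in Ioi r, r ^ (σ - 1) * Real.exp (-c * x) := by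
        rw [integral_const_mul, integral_exp_mul_Ioi (neg_lt_zero.2 hc), neg_div_neg_eq]
    _ ≤ ∫ x in Ioi r, x ^ (σ - 1) * Real.exp (-c * x) := by
        refine setIntegral_mono_on ((integrableOn_exp_mul_Ioi (neg_lt_zero.2 hc) r).const_mul _)
          (hint.mono_set hsub) measurableSet_Ioi fun x (hx : r < x) => ?_
        gcongr
    _ ≤ ∫ x in Ioi 1, x ^ (σ - 1) * Real.exp (-c * x) := by
        refine setIntegral_mono_set hint ?_ (Eventually.of_forall hsub)
        filter_upwards [ae_restrict_mem measurableSet_Ioi] with x hx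
        have hx0 : 0 < x := one_pos.trans hx
        positivity

theorem rpow_le_exp_mul_exp {x a : ℝ} (hx : 0 < x) (ha : 0 < a) :
    x ^ a ≤ Real.exp (2 * a ^ (3 / 2 : ℝ)) * Real.exp x := by
  have hsqrt : 0 < √a := Real.sqrt_pos.2 ha
  have hpow : a ^ (3 / 2 : ℝ) = a * √a := by
    rw [Real.sqrt_eq_rpow, ← Real.rpow_one_add' ha.le (by norm_num)]
    norm_num
  have hlog_a : Real.log a ≤ 2 * (√a - 1) := by
    have hlog := Real.log_le_sub_one_of_pos hsqrt
    rw [Real.log_sqrt ha.le] at hlog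
    linarith
  have hlog_x : Real.log x - Real.log a ≤ x / a - 1 :=
    Real.log_div hx.ne' ha.ne' ▸ Real.log_le_sub_one_of_pos (div_pos hx ha)
  rw [Real.rpow_def_of_pos hx, ← Real.exp_add, Real.exp_le_exp, hpow]
  calc Real.log x * a ≤ (x / a + 2 * √a) * a := by
        gcongr
        linarith
    _ = 2 * (a * √a) + x := by
        field_simp
        ring

theorem expIntegral_re_le_exp {a σ : ℝ} (hc : 1 < c) (ha : 0 < a) (hσ : σ - 1 ≤ a) :
    (expIntegral c σ).re
      ≤ Real.exp (2 * a ^ (3 / 2 : ℝ)) * (Real.exp (-(c - 1)) / (c - 1)) := by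
  have hc1 : 0 < c - 1 := sub_pos.2 hc
  have hone := congrArg Complex.re (expIntegral_one hc1)
  rw [← Complex.ofReal_one, expIntegral_ofReal, Complex.ofReal_re, Complex.ofReal_re] at hone
  rw [expIntegral_ofReal, Complex.ofReal_re, ← hone, ← integral_const_mul]
  refine setIntegral_mono_on (integrableOn_rpow_mul_exp _ (one_pos.trans hc))
    ((integrableOn_rpow_mul_exp _ hc1).const_mul _) measurableSet_Ioi fun x (hx : 1 < x) => ?_
  have hx0 : 0 < x := one_pos.trans hx
  calc x ^ (σ - 1) * Real.exp (-c * x) ≤ x ^ a * Real.exp (-c * x) := by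
        gcongr
        exact hx.le
    _ ≤ Real.exp (2 * a ^ (3 / 2 : ℝ)) * Real.exp x * Real.exp (-c * x) := by
        gcongr
        exact rpow_le_exp_mul_exp hx0 ha
    _ = Real.exp (2 * a ^ (3 / 2 : ℝ)) * (x ^ (1 - 1 : ℝ) * Real.exp (-(c - 1) * x)) := by
        rw [sub_self, Real.rpow_zero, one_mul, mul_assoc, ← Real.exp_add]
        ring_nf

end ExpIntegral

/-! ### The integral of the theta function -/

section ThetaIntegral

/-- The exponent `π (n + 1)²` of the `n`-th term of the series
`(θ(x) - 1) / 2 = ∑_{n ≥ 0} exp (-π (n + 1)² x)`. -/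
noncomputable def thetaExponent (n : ℕ) : ℝ := Real.pi * ((n : ℝ) + 1) ^ 2

theorem three_mul_add_one_le_thetaExponent (n : ℕ) : 3 * ((n : ℝ) + 1) ≤ thetaExponent n := by
  have hsq : (n : ℝ) + 1 ≤ ((n : ℝ) + 1) ^ 2 := le_self_pow₀ (by simp) two_ne_zero
  exact mul_le_mul Real.pi_gt_three.le hsq (by positivity) Real.pi_pos.le

theorem three_le_thetaExponent (n : ℕ) : 3 ≤ thetaExponent n := by
  linarith [three_mul_add_one_le_thetaExponent n, n.cast_nonneg (α := ℝ)]

theorem thetaExponent_pos (n : ℕ) : 0 < thetaExponent n :=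
  three_pos.trans_le (three_le_thetaExponent n)

theorem hasSum_theta {x : ℝ} (hx : 0 < x) :
    HasSum (fun n : ℕ => (Real.exp (-thetaExponent n * x) : ℂ)) ((theta x - 1) / 2) := by
  refine (hasSum_nat_jacobiTheta (τ := Complex.I * x) (by simpa using hx)).congr_fun fun n => ?_
  rw [thetaExponent]
  push_cast
  congr 1
  linear_combination (-(Real.pi : ℂ) * ((n : ℂ) + 1) ^ 2 * x) * Complex.I_sq

theorem exp_neg_three_le : Real.exp (-3) ≤ 1 / 20 := by
  have hexp : Real.exp 3 = Real.exp 1 ^ 3 := by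
    rw [← Real.exp_nat_mul]
    norm_num
  rw [Real.exp_neg, inv_le_comm₀ (Real.exp_pos _) (by norm_num), hexp]
  calc (1 / 20 : ℝ)⁻¹ ≤ (2.7182818283 : ℝ) ^ 3 := by norm_num
    _ ≤ _ := by
        gcongr
        exact Real.exp_one_gt_d9.le

theorem exp_three_sub_thetaExponent_le (n : ℕ) :
    Real.exp (3 - thetaExponent n) ≤ (1 / 20) ^ n :=
  calc Real.exp (3 - thetaExponent n) ≤ Real.exp (n * (-3)) := by
        gcongr
        linarith [three_mul_add_one_le_thetaExponent n]
    _ = Real.exp (-3) ^ n := Real.exp_nat_mul _ _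
    _ ≤ (1 / 20) ^ n := by
        gcongr
        exact exp_neg_three_le

theorem exp_neg_thetaExponent_le (n : ℕ) :
    Real.exp (-thetaExponent n) ≤ (1 / 20) ^ n * (1 / 20) :=
  calc Real.exp (-thetaExponent n) = Real.exp (3 - thetaExponent n) * Real.exp (-3) := by
        rw [← Real.exp_add]
        ring_nf
    _ ≤ (1 / 20) ^ n * (1 / 20) := by
        gcongr
        exacts [exp_three_sub_thetaExponent_le n, exp_neg_three_le]

theorem hasSum_geometric_one_div_twenty_mul (C : ℝ) :
    HasSum (fun n : ℕ => (1 / 20 : ℝ) ^ n * C) (20 / 19 * C) := by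
  have hratio : (20 / 19 : ℝ) = (1 - 1 / 20)⁻¹ := by norm_num
  rw [hratio]
  exact (hasSum_geometric_of_lt_one (by norm_num) (by norm_num)).mul_right C

theorem summable_exp_neg_thetaExponent : Summable fun n => Real.exp (-thetaExponent n) :=
  .of_nonneg_of_le (fun _ => (Real.exp_pos _).le) exp_neg_thetaExponent_le
    (hasSum_geometric_one_div_twenty_mul _).summable

theorem tsum_exp_neg_thetaExponent_le : ∑' n, Real.exp (-thetaExponent n) ≤ 1 / 19 := by
  have hle := hasSum_le exp_neg_thetaExponent_le summable_exp_neg_thetaExponent.hasSum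
    (hasSum_geometric_one_div_twenty_mul _)
  linarith

theorem expIntegral_thetaExponent_re_le (n : ℕ) (σ : ℝ) :
    (expIntegral (thetaExponent n) σ).re ≤ (1 / 20) ^ n * (expIntegral 3 σ).re :=
  (expIntegral_re_le_exp_mul three_pos (three_le_thetaExponent n) σ).trans
    (mul_le_mul_of_nonneg_right (exp_three_sub_thetaExponent_le n) (expIntegral_re_nonneg 3 σ))

theorem thetaIntegral_eq (s : ℂ) :
    thetaIntegral s = ∫ x in Ioi (1 : ℝ), (x : ℂ) ^ (s / 2 - 1) * ((theta x - 1) / 2) := by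
  refine setIntegral_congr_fun measurableSet_Ioi fun x hx => ?_
  have hx0 : (x : ℂ) ≠ 0 := Complex.ofReal_ne_zero.2 (one_pos.trans hx).ne'
  simp only [Complex.cpow_sub _ _ hx0, Complex.cpow_one]
  ring

theorem hasSum_thetaIntegral (s : ℂ) :
    HasSum (fun n => expIntegral (thetaExponent n) (s / 2)) (thetaIntegral s) := by
  have hsum : Summable fun n : ℕ => ∫ x in Ioi (1 : ℝ),
      ‖(x : ℂ) ^ (s / 2 - 1) * (Real.exp (-thetaExponent n * x) : ℂ)‖ := by
    simp only [integral_norm_cpow_mul_exp]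
    exact .of_nonneg_of_le (fun n => expIntegral_re_nonneg _ _)
      (fun n => expIntegral_thetaExponent_re_le n _)
      (hasSum_geometric_one_div_twenty_mul _).summable
  have hinterchange := hasSum_integral_of_summable_integral_norm
    (fun n => integrableOn_cpow_mul_exp (s / 2) (thetaExponent_pos n)) hsum
  have hseries : ∀ x ∈ Ioi (1 : ℝ),
      ∑' n : ℕ, (x : ℂ) ^ (s / 2 - 1) * (Real.exp (-thetaExponent n * x) : ℂ)
        = (x : ℂ) ^ (s / 2 - 1) * ((theta x - 1) / 2) := fun x hx =>
    ((hasSum_theta (one_pos.trans hx)).mul_left _).tsum_eq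
  rwa [setIntegral_congr_fun measurableSet_Ioi hseries, ← thetaIntegral_eq] at hinterchange

theorem norm_thetaIntegral_le (s : ℂ) :
    ‖thetaIntegral s‖ ≤ 20 / 19 * (expIntegral 3 (s / 2).re).re := by
  rw [← (hasSum_thetaIntegral s).tsum_eq]
  refine tsum_of_norm_bounded (hasSum_geometric_one_div_twenty_mul _) fun n => ?_
  exact (norm_expIntegral_le _ _).trans (expIntegral_thetaExponent_re_le n _)

theorem thetaIntegral_conj (s : ℂ) :
    thetaIntegral (starRingEnd ℂ s) = starRingEnd ℂ (thetaIntegral s) := by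
  refine (hasSum_thetaIntegral _).unique
    (((hasSum_thetaIntegral s).map (starRingEnd ℂ) Complex.continuous_conj).congr_fun fun n => ?_)
  rw [Function.comp_apply, ← expIntegral_conj, map_div₀, map_ofNat]

theorem thetaIntegral_ofReal (σ : ℝ) : thetaIntegral σ = ((thetaIntegral σ).re : ℂ) := by
  rw [eq_comm, ← Complex.conj_eq_iff_re, ← thetaIntegral_conj, Complex.conj_ofReal]

theorem hasSum_thetaIntegral_re (σ : ℝ) :
    HasSum (fun n => (expIntegral (thetaExponent n) (σ / 2 : ℝ)).re) (thetaIntegral σ).re := by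
  simpa only [Complex.ofReal_div, Complex.ofReal_ofNat] using
    Complex.hasSum_re (hasSum_thetaIntegral σ)

theorem thetaIntegral_re_mono : Monotone fun σ : ℝ => (thetaIntegral σ).re := fun σ σ' hσ =>
  hasSum_le (fun n => expIntegral_re_mono (thetaExponent_pos n) (by gcongr))
    (hasSum_thetaIntegral_re σ) (hasSum_thetaIntegral_re σ')

theorem expIntegral_pi_re_le_thetaIntegral_re (σ : ℝ) :
    (expIntegral Real.pi (σ / 2 : ℝ)).re ≤ (thetaIntegral σ).re := by
  have hle := le_hasSum (hasSum_thetaIntegral_re σ) 0 fun n _ => expIntegral_re_nonneg _ _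
  rwa [thetaExponent, Nat.cast_zero, zero_add, one_pow, mul_one] at hle

theorem thetaIntegral_re_nonneg (σ : ℝ) : 0 ≤ (thetaIntegral σ).re :=
  (expIntegral_re_nonneg _ _).trans (expIntegral_pi_re_le_thetaIntegral_re σ)

theorem thetaIntegral_re_lt_one {σ : ℝ} (hσ : σ ≤ 2) : (thetaIntegral σ).re < 1 := by
  have hmono := expIntegral_re_mono (c := 3) three_pos (show (σ / 2 : ℂ).re ≤ 1 by
    rw [Complex.div_ofNat_re, Complex.ofReal_re]
    linarith)
  have hone : (expIntegral 3 ((1 : ℝ) : ℂ)).re = Real.exp (-3) / 3 := by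
    rw [Complex.ofReal_one, expIntegral_one three_pos, Complex.ofReal_re]
  have hle := (Complex.re_le_norm _).trans (norm_thetaIntegral_le σ)
  linarith [exp_neg_three_le]

theorem norm_thetaIntegral_le_exp (s : ℂ) :
    ‖thetaIntegral s‖ ≤ Real.exp (2 * (1 + ‖s‖) ^ (3 / 2 : ℝ)) := by
  have hre : (s / 2).re - 1 ≤ 1 + ‖s‖ := by
    rw [Complex.div_ofNat_re]
    linarith [Complex.re_le_norm s, norm_nonneg s]
  have hle := expIntegral_re_le_exp (c := 3) (by norm_num) (by positivity) hre
  have hexp : Real.exp (-(3 - 1)) / (3 - 1) ≤ 1 / 2 :=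
    div_le_div₀ zero_le_one (Real.exp_le_one_iff.2 (by norm_num)) two_pos (by norm_num)
  calc ‖thetaIntegral s‖ ≤ 20 / 19 * (expIntegral 3 (s / 2).re).re := norm_thetaIntegral_le s
    _ ≤ 20 / 19 * (Real.exp (2 * (1 + ‖s‖) ^ (3 / 2 : ℝ)) * (1 / 2)) := by
        gcongr
        exact hle.trans (by gcongr)
    _ ≤ Real.exp (2 * (1 + ‖s‖) ^ (3 / 2 : ℝ)) := by
        linarith [Real.exp_pos (2 * (1 + ‖s‖) ^ (3 / 2 : ℝ))]

theorem norm_I_mul_im_mul_thetaIntegral_add_le {s : ℂ} (hs : s.re ≤ 6) :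
    ‖Complex.I * (s / 2).im * thetaIntegral s + (∑' n, Real.exp (-thetaExponent n) : ℝ)‖
      ≤ ∑' n, Real.exp (-thetaExponent n) := by
  have hsum := summable_exp_neg_thetaExponent.hasSum
  have hterms := ((hasSum_thetaIntegral s).mul_left (Complex.I * (s / 2).im)).add
    (Complex.hasSum_ofReal.2 hsum)
  rw [← hterms.tsum_eq]
  refine tsum_of_norm_bounded hsum fun n =>
    norm_I_mul_im_mul_expIntegral_add_exp_le (thetaExponent_pos n) ?_
  rw [Complex.div_ofNat_re]
  linarith [three_le_thetaExponent n]

theorem thetaIntegral_im_nonneg {s : ℂ} (hs : 0 < s.im) (hre : s.re ≤ 6) :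
    0 ≤ (thetaIntegral s).im := by
  have hle := (Complex.re_le_norm _).trans (norm_I_mul_im_mul_thetaIntegral_add_le hre)
  rw [Complex.add_re, Complex.ofReal_re, add_le_iff_nonpos_left, mul_assoc, Complex.I_mul_re,
    Complex.im_ofReal_mul, neg_nonpos, Complex.div_ofNat_im] at hle
  exact nonneg_of_mul_nonneg_right hle (half_pos hs)

theorem abs_re_thetaIntegral_le {s : ℂ} (hs : 0 < s.im) (hre : s.re ≤ 6) :
    |(thetaIntegral s).re| ≤ 2 / 19 / s.im := by
  have hle := (Complex.abs_im_le_norm _).trans (norm_I_mul_im_mul_thetaIntegral_add_le hre)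
  rw [Complex.add_im, Complex.ofReal_im, add_zero, mul_assoc, Complex.I_mul_im,
    Complex.re_ofReal_mul, Complex.div_ofNat_im, abs_mul, abs_of_pos (half_pos hs)] at hle
  rw [le_div_iff₀ hs]
  linarith [tsum_exp_neg_thetaExponent_le]

theorem re_sLam_ofReal (σ : ℝ) : (sLam σ).re = -1 + σ * (thetaIntegral σ).re := by
  rw [sLam, Complex.add_re, Complex.re_ofReal_mul, Complex.neg_re, Complex.one_re]

theorem norm_sLam_le (s : ℂ) : ‖sLam s‖ ≤ Real.exp (3 * (1 + ‖s‖) ^ (3 / 2 : ℝ)) := by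
  set y := (1 + ‖s‖) ^ (3 / 2 : ℝ)
  have hle : 1 + ‖s‖ ≤ y :=
    Real.self_le_rpow_of_one_le (le_add_of_nonneg_right (norm_nonneg s)) (by norm_num)
  have hone : 1 ≤ Real.exp (2 * y) := Real.one_le_exp (by positivity)
  calc ‖sLam s‖ ≤ ‖(-1 : ℂ)‖ + ‖s * thetaIntegral s‖ := norm_add_le _ _
    _ ≤ Real.exp (2 * y) + ‖s‖ * Real.exp (2 * y) := by
        rw [norm_neg, norm_one, norm_mul]
        gcongr
        exact norm_thetaIntegral_le_exp s
    _ = (‖s‖ + 1) * Real.exp (2 * y) := by ring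
    _ ≤ Real.exp y * Real.exp (2 * y) := by
        gcongr
        exact (Real.add_one_le_exp _).trans (Real.exp_le_exp.2 (by linarith))
    _ = Real.exp (3 * y) := by
        rw [← Real.exp_add]
        ring_nf

theorem exists_exp_mul_lt_re_sLam {C : ℝ} (hC : 0 ≤ C) :
    ∃ σ : ℝ, 0 < σ ∧ Real.exp (C * σ) < (sLam σ).re := by
  set r := Real.exp (2 * C) with hr
  set K := Real.exp (-(2 * C)) * (Real.exp (-Real.pi * r) / Real.pi) with hK
  have hKpos : 0 < K := by positivity
  set σ := max 2 (3 / K)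
  have hσ : 2 ≤ σ := le_max_left _ _
  have hσK : 3 ≤ σ * K := (div_le_iff₀ hKpos).1 (le_max_right _ _)
  have hint : K * Real.exp (C * σ) ≤ (thetaIntegral σ).re :=
    calc K * Real.exp (C * σ) = r ^ (σ / 2 - 1) * (Real.exp (-Real.pi * r) / Real.pi) := by
          rw [hr, ← Real.exp_mul, hK, mul_right_comm, ← Real.exp_add, ← hr]
          ring_nf
      _ ≤ (expIntegral Real.pi (σ / 2 : ℝ)).re :=
          rpow_mul_exp_div_le_expIntegral_re Real.pi_pos (Real.one_le_exp (by positivity))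
            (by linarith)
      _ ≤ (thetaIntegral σ).re := expIntegral_pi_re_le_thetaIntegral_re σ
  have hone : 1 ≤ Real.exp (C * σ) := Real.one_le_exp (by positivity)
  refine ⟨σ, by linarith, ?_⟩
  rw [re_sLam_ofReal]
  calc Real.exp (C * σ) < -1 + 3 * Real.exp (C * σ) := by linarith
    _ ≤ -1 + σ * K * Real.exp (C * σ) := by gcongr
    _ ≤ -1 + σ * (thetaIntegral σ).re := by
        rw [mul_assoc]
        gcongr

end ThetaIntegral

/-! ### The completed zeta function -/

section CompletedZeta

theorem evenKernel_zero_eq_theta (x : ℝ) : (HurwitzZeta.evenKernel 0 x : ℂ) = theta x := by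
  have hdef := HurwitzZeta.evenKernel_def 0 x
  rw [AddCircle.coe_zero] at hdef
  simp [hdef, theta, jacobiTheta_eq_jacobiTheta₂]

/-- The function `θ - 1` cut off to `(1, ∞)`, so that `s ↦ 2 * thetaIntegral (2 * s)` is a Mellin
transform. -/
noncomputable def thetaCut : ℝ → ℂ :=
  (Ioi 1).indicator fun x => (HurwitzZeta.evenKernel 0 x : ℂ) - 1

theorem locallyIntegrableOn_thetaCut : LocallyIntegrableOn thetaCut (Ioi 0) := by
  have hkernel : LocallyIntegrableOn (fun x => (HurwitzZeta.evenKernel 0 x : ℂ) - 1) (Ioi 0) :=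
    (HurwitzZeta.hurwitzEvenFEPair 0).hf_int.sub (locallyIntegrableOn_const _)
  intro x hx
  obtain ⟨U, hU, hint⟩ := hkernel x hx
  exact ⟨U, hU, hint.indicator measurableSet_Ioi⟩

theorem exists_isBigO_thetaCut :
    ∃ p : ℝ, 0 < p ∧ thetaCut =O[atTop] fun x => Real.exp (-p * x) := by
  obtain ⟨p, hp, hO⟩ := HurwitzZeta.isBigO_atTop_evenKernel_sub 0
  refine ⟨p, hp, (Asymptotics.isBigO_of_le _ fun x => ?_).trans hO⟩
  refine (norm_indicator_le_norm_self _ _).trans_eq ?_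
  rw [if_pos rfl, ← Complex.ofReal_one, ← Complex.ofReal_sub, Complex.norm_real]

theorem isBigO_thetaCut_zero (b : ℝ) : thetaCut =O[𝓝[>] 0] fun x => x ^ (-b) := by
  have hzero : thetaCut =ᶠ[𝓝[>] 0] fun _ => 0 := by
    filter_upwards [nhdsWithin_le_nhds (eventually_lt_nhds (zero_lt_one' ℝ))] with x hx
    exact indicator_of_notMem (notMem_Ioi.2 hx.le) _
  exact hzero.trans_isBigO (Asymptotics.isBigO_zero _ _)

theorem mellinConvergent_thetaCut (s : ℂ) : MellinConvergent thetaCut s := by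
  obtain ⟨p, hp, hO⟩ := exists_isBigO_thetaCut
  exact mellinConvergent_of_isBigO_rpow_exp hp locallyIntegrableOn_thetaCut hO
    (isBigO_thetaCut_zero (s.re - 1)) (sub_one_lt _)

theorem differentiable_mellin_thetaCut : Differentiable ℂ (mellin thetaCut) := by
  obtain ⟨p, hp, hO⟩ := exists_isBigO_thetaCut
  exact fun s => mellin_differentiableAt_of_isBigO_rpow_exp hp locallyIntegrableOn_thetaCut hO
    (isBigO_thetaCut_zero (s.re - 1)) (sub_one_lt _)

theorem thetaIntegral_eq_mellin (s : ℂ) : thetaIntegral s = mellin thetaCut (s / 2) / 2 := by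
  have hcut : (fun x : ℝ => (x : ℂ) ^ (s / 2 - 1) • thetaCut x / 2) = (Ioi 1).indicator
      fun x : ℝ => (x : ℂ) ^ (s / 2 - 1) * ((theta x - 1) / 2) := by
    ext x
    by_cases hx : x ∈ Ioi (1 : ℝ)
    · rw [thetaCut, indicator_of_mem hx, indicator_of_mem hx, evenKernel_zero_eq_theta,
        smul_eq_mul, mul_div_assoc]
    · rw [thetaCut, indicator_of_notMem hx, indicator_of_notMem hx, smul_zero, zero_div]
  rw [thetaIntegral_eq, mellin, ← integral_div, hcut, setIntegral_indicator measurableSet_Ioi,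
    inter_eq_self_of_subset_right (Ioi_subset_Ioi zero_le_one)]

theorem differentiable_thetaIntegral : Differentiable ℂ thetaIntegral := by
  rw [funext thetaIntegral_eq_mellin]
  exact (differentiable_mellin_thetaCut.comp (differentiable_id.div_const 2)).div_const 2

theorem differentiable_sLam : Differentiable ℂ sLam :=
  (differentiable_const _).add (differentiable_id.mul differentiable_thetaIntegral)

theorem f_modif_eq_thetaCut_add {x : ℝ} (hx : x ∈ Ioi (0 : ℝ)) :
    (HurwitzZeta.hurwitzEvenFEPair 0).f_modif x
      = thetaCut x + (x : ℂ) ^ (-(1 / 2) : ℂ) • thetaCut x⁻¹ := by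
  have hx0 : 0 < x := hx
  simp only [WeakFEPair.f_modif, HurwitzZeta.hurwitzEvenFEPair, Pi.add_apply, if_true, one_mul,
    Function.comp_apply, smul_eq_mul, mul_one, thetaCut]
  congr 1
  by_cases hx1 : x < 1
  · have hpow : (x : ℂ) ^ (-(1 / 2) : ℂ) = (((x ^ (1 / 2 : ℝ))⁻¹ : ℝ) : ℂ) := by
      rw [← Real.rpow_neg hx0.le, Complex.ofReal_cpow hx0.le]
      push_cast
      rfl
    rw [indicator_of_mem (show x ∈ Ioo (0 : ℝ) 1 from ⟨hx0, hx1⟩),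
      indicator_of_mem (show x⁻¹ ∈ Ioi (1 : ℝ) from (one_lt_inv₀ hx0).2 hx1),
      HurwitzZeta.evenKernel_functional_equation, ← HurwitzZeta.evenKernel_eq_cosKernel_of_zero,
      one_div x, Real.rpow_neg hx0.le, mul_sub, mul_one, hpow]
    push_cast
    simp only [one_div]
  · have hinv : x⁻¹ ∉ Ioi (1 : ℝ) := notMem_Ioi.2 (inv_le_one_of_one_le₀ (not_lt.1 hx1))
    rw [indicator_of_notMem fun h => hx1 h.2, indicator_of_notMem hinv, mul_zero]

theorem completedRiemannZeta₀_eq (s : ℂ) :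
    completedRiemannZeta₀ s = thetaIntegral s + thetaIntegral (1 - s) := by
  have hinv : MellinConvergent (fun x : ℝ => (x : ℂ) ^ (-(1 / 2) : ℂ) • thetaCut x⁻¹) (s / 2) := by
    refine MellinConvergent.cpow_smul.2 ?_
    simpa only [Real.rpow_neg_one] using (MellinConvergent.comp_rpow (f := thetaCut)
      (s := s / 2 + -(1 / 2)) (neg_ne_zero.2 one_ne_zero)).2 (mellinConvergent_thetaCut _)
  have hmodif : mellin (HurwitzZeta.hurwitzEvenFEPair 0).f_modif (s / 2)
      = mellin (fun x : ℝ => thetaCut x + (x : ℂ) ^ (-(1 / 2) : ℂ) • thetaCut x⁻¹) (s / 2) :=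
    setIntegral_congr_fun measurableSet_Ioi fun x hx => by simp only [f_modif_eq_thetaCut_add hx]
  have hreflect : -(s / 2 + -(1 / 2)) = (1 - s) / 2 := by ring
  calc completedRiemannZeta₀ s
      = mellin (HurwitzZeta.hurwitzEvenFEPair 0).f_modif (s / 2) / 2 := rfl
    _ = (mellin thetaCut (s / 2) + mellin thetaCut ((1 - s) / 2)) / 2 := by
        rw [hmodif, (hasMellin_add (mellinConvergent_thetaCut (s / 2)) hinv).2, mellin_cpow_smul,
          mellin_comp_inv, hreflect]
    _ = thetaIntegral s + thetaIntegral (1 - s) := by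
        rw [thetaIntegral_eq_mellin, thetaIntegral_eq_mellin, add_div]

theorem completedRiemannZeta_eq_Lam (s : ℂ) :
    completedRiemannZeta s = Lam s + Lam (1 - s) := by
  rw [completedRiemannZeta_eq, completedRiemannZeta₀_eq, Lam, Lam]
  ring

theorem Lam_conj (s : ℂ) : Lam (starRingEnd ℂ s) = starRingEnd ℂ (Lam s) := by
  simp [Lam, thetaIntegral_conj]

theorem sLam_conj (s : ℂ) : sLam (starRingEnd ℂ s) = starRingEnd ℂ (sLam s) := by
  simp [sLam, thetaIntegral_conj]

theorem sLam_ofReal (σ : ℝ) : sLam σ = ((sLam σ).re : ℂ) := by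
  rw [eq_comm, ← Complex.conj_eq_iff_re, ← sLam_conj, Complex.conj_ofReal]

theorem crit_re (t : ℝ) : (crit t).re = 1 / 2 := by simp [crit]

theorem crit_im (t : ℝ) : (crit t).im = t := by simp [crit]

theorem crit_neg (t : ℝ) : crit (-t) = starRingEnd ℂ (crit t) := by
  apply Complex.ext <;> simp [crit]

theorem one_sub_crit (t : ℝ) : 1 - crit t = starRingEnd ℂ (crit t) := by
  rw [← crit_neg, crit, crit]
  push_cast
  ring

theorem crit_ne_zero (t : ℝ) : crit t ≠ 0 :=
  ne_of_apply_ne Complex.re (by simp [crit_re])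

theorem continuous_crit : Continuous crit := by
  unfold crit
  fun_prop

theorem Gammaℝ_crit_ne_zero (t : ℝ) : Complex.Gammaℝ (crit t) ≠ 0 :=
  Complex.Gammaℝ_ne_zero_of_re_pos (by simp [crit_re])

theorem Z_eq (t : ℝ) : Z t = (2 * (Lam (crit t)).re / ‖Complex.Gammaℝ (crit t)‖ : ℝ) := by
  have hreal : completedRiemannZeta (crit t) = (2 * (Lam (crit t)).re : ℝ) := by
    rw [completedRiemannZeta_eq_Lam, one_sub_crit, Lam_conj, Complex.add_conj]
  have hΓ := Gammaℝ_crit_ne_zero t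
  rw [Z, riemannZeta_def_of_ne_zero (crit_ne_zero t), hreal]
  push_cast
  field_simp

end CompletedZeta

/-! ### The argument of `Λ` on the critical line -/

section Argument

theorem arg_eq_arctan {z : ℂ} (hz : 0 < z.re) : z.arg = Real.arctan (z.im / z.re) := by
  have harg := abs_lt.1 (Complex.abs_arg_lt_pi_div_two_iff.2 (.inl hz))
  rw [← Complex.tan_arg, Real.arctan_tan harg.1 harg.2]

theorem arg_eq_pi_div_two_sub_arctan {z : ℂ} (hz : 0 < z.im) :
    z.arg = Real.pi / 2 - Real.arctan (z.re / z.im) := by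
  have hre : (-Complex.I * z).re = z.im := by simp
  have him : (-Complex.I * z).im = -z.re := by simp
  have hrot : z = Complex.I * (-Complex.I * z) := by
    linear_combination z * Complex.I_sq
  have hw : (-Complex.I * z).arg = -Real.arctan (z.re / z.im) := by
    rw [arg_eq_arctan (hre ▸ hz), hre, him, neg_div, Real.arctan_neg]
  have hw0 : -Complex.I * z ≠ 0 := ne_of_apply_ne Complex.re (by simpa [hre] using hz.ne')
  have hlt := Real.arctan_lt_pi_div_two (z.re / z.im)
  have hgt := Real.neg_pi_div_two_lt_arctan (z.re / z.im)
  rw [hrot, (Complex.arg_mul_eq_add_arg_iff Complex.I_ne_zero hw0).2, ← hrot, hw, Complex.arg_I,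
    sub_eq_add_neg]
  rw [hw, Complex.arg_I]
  constructor <;> linarith

theorem abs_arctan_le (x : ℝ) : |Real.arctan x| ≤ |x| := by
  wlog hx : 0 ≤ x generalizing x
  · rw [← abs_neg, ← Real.arctan_neg, ← abs_neg x]
    exact this (-x) (by linarith)
  rw [abs_of_nonneg hx, abs_of_nonneg (Real.arctan_nonneg.2 hx)]
  exact (Real.le_tan (Real.arctan_nonneg.2 hx) (Real.arctan_lt_pi_div_two x)).trans_eq
    (Real.tan_arctan x)

theorem sinc_pos {x : ℝ} (hx : |x| < Real.pi) : 0 < Real.sinc x := by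
  wlog hpos : 0 < x generalizing x
  · rcases (not_lt.1 hpos).eq_or_lt with rfl | hneg
    · rw [Real.sinc_zero]
      exact one_pos
    · rw [← Real.sinc_neg]
      exact this (by rwa [abs_neg]) (neg_pos.2 hneg)
  rw [Real.sinc_of_ne_zero hpos.ne']
  exact div_pos (Real.sin_pos_of_pos_of_lt_pi hpos (abs_lt.1 hx).2) hpos

theorem sinc_mul_self (x : ℝ) : Real.sinc x * x = Real.sin x := by
  rcases eq_or_ne x 0 with rfl | hx
  · simp
  · rw [Real.sinc_of_ne_zero hx, div_mul_cancel₀ _ hx]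

theorem Lam_re (s : ℂ) : (Lam s).re = -s.re / Complex.normSq s + (thetaIntegral s).re := by
  simp [Lam, Complex.div_re]

theorem Lam_im (s : ℂ) : (Lam s).im = s.im / Complex.normSq s + (thetaIntegral s).im := by
  simp [Lam, neg_div]

theorem Lam_im_pos {s : ℂ} (hs : 0 < s.im) (hre : s.re ≤ 6) : 0 < (Lam s).im := by
  rw [Lam_im]
  have hnormSq : 0 < Complex.normSq s :=
    Complex.normSq_pos.2 (ne_of_apply_ne Complex.im hs.ne')
  have hint := thetaIntegral_im_nonneg hs hre
  positivity

theorem sLam_ne_zero_of_im_pos {s : ℂ} (hs : 0 < s.im) (hre : s.re ≤ 6) : sLam s ≠ 0 := by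
  have hs0 : s ≠ 0 := ne_of_apply_ne Complex.im hs.ne'
  rw [sLam_eq hs0]
  exact mul_ne_zero hs0 (ne_of_apply_ne Complex.im (Lam_im_pos hs hre).ne')

theorem re_sLam_neg {σ : ℝ} (hσ : σ ≤ 1) : (sLam σ).re < 0 := by
  rw [re_sLam_ofReal]
  have hnonneg := thetaIntegral_re_nonneg σ
  have hlt := thetaIntegral_re_lt_one (hσ.trans one_le_two)
  nlinarith

theorem sLam_ne_zero {s : ℂ} (hre : s.re ≤ 1) : sLam s ≠ 0 := by
  rcases lt_trichotomy s.im 0 with him | him | him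
  · have hconj := sLam_ne_zero_of_im_pos (s := starRingEnd ℂ s) (by simpa using him)
      (by rw [Complex.conj_re]; linarith)
    rwa [sLam_conj, map_ne_zero] at hconj
  · rw [Complex.ext (Complex.ofReal_re s.re).symm (him.trans (Complex.ofReal_im s.re).symm)]
    exact ne_of_apply_ne Complex.re (re_sLam_neg hre).ne
  · exact sLam_ne_zero_of_im_pos him (by linarith)

theorem Lam_crit_im_pos {t : ℝ} (ht : 0 < t) : 0 < (Lam (crit t)).im :=
  Lam_im_pos (by rwa [crit_im]) (by rw [crit_re]; norm_num)

theorem crit_zero : crit 0 = ((1 / 2 : ℝ) : ℂ) := by simp [crit]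

theorem Lam_crit_zero : ∃ r : ℝ, r < 0 ∧ Lam (crit 0) = r := by
  have hneg := re_sLam_neg (σ := 1 / 2) (by norm_num)
  rw [← crit_zero, sLam_eq (crit_ne_zero 0), crit_zero, Complex.re_ofReal_mul] at hneg
  refine ⟨(Lam (crit 0)).re, by rw [crit_zero]; linarith, ?_⟩
  rw [eq_comm, ← Complex.conj_eq_iff_re, ← Lam_conj, crit_zero, Complex.conj_ofReal]

theorem neg_Lam_crit_mem_slitPlane (t : ℝ) : -Lam (crit t) ∈ Complex.slitPlane := by
  rcases lt_trichotomy t 0 with ht | rfl | ht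
  · have him := Lam_crit_im_pos (neg_pos.2 ht)
    rw [crit_neg, Lam_conj, Complex.conj_im, ← Complex.neg_im] at him
    exact .inr him.ne'
  · obtain ⟨r, hr, hLam⟩ := Lam_crit_zero
    rw [hLam, ← Complex.ofReal_neg, Complex.ofReal_mem_slitPlane]
    exact neg_pos.2 hr
  · exact .inr (by simpa using (Lam_crit_im_pos ht).ne')

theorem Lam_crit_ne_zero (t : ℝ) : Lam (crit t) ≠ 0 :=
  neg_ne_zero.1 (Complex.slitPlane_ne_zero (neg_Lam_crit_mem_slitPlane t))

theorem continuous_Lam_crit : Continuous fun t : ℝ => Lam (crit t) :=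
  (continuous_const.div continuous_crit crit_ne_zero).add
    (differentiable_thetaIntegral.continuous.comp continuous_crit)

/-- The continuous determination of `arg Λ(1/2 + it)` that is close to `π / 2` for large `t`. The
values `-Λ(1/2 + it)` avoid the negative real axis, so their principal argument is continuous. -/
noncomputable def argLam (t : ℝ) : ℝ := Real.pi + (-Lam (crit t)).arg

theorem continuous_argLam : Continuous argLam :=
  continuous_const.add (continuous_iff_continuousAt.2 fun t =>
    (Complex.continuousAt_arg (neg_Lam_crit_mem_slitPlane t)).comp
      (f := fun t => -Lam (crit t)) continuous_Lam_crit.neg.continuousAt)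

theorem argLam_polar (t : ℝ) :
    Lam (crit t) = (‖Lam (crit t)‖ : ℂ) * Complex.exp ((argLam t : ℂ) * Complex.I) := by
  have hpolar := Complex.norm_mul_exp_arg_mul_I (-Lam (crit t))
  rw [norm_neg] at hpolar
  rw [argLam, Complex.ofReal_add, add_mul, Complex.exp_add, Complex.exp_pi_mul_I]
  linear_combination hpolar

theorem argLam_zero : argLam 0 = Real.pi := by
  obtain ⟨r, hr, hLam⟩ := Lam_crit_zero
  rw [argLam, hLam, ← Complex.ofReal_neg, Complex.arg_ofReal_of_nonneg (neg_pos.2 hr).le, add_zero]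

theorem argLam_eq_pi_div_two_sub_arctan {t : ℝ} (ht : 0 < t) :
    argLam t = Real.pi / 2 - Real.arctan ((Lam (crit t)).re / (Lam (crit t)).im) := by
  have him := Lam_crit_im_pos ht
  rw [argLam, Complex.arg_neg_eq_arg_sub_pi_of_im_pos him, add_sub_cancel,
    arg_eq_pi_div_two_sub_arctan him]

theorem abs_re_Lam_crit_lt {t : ℝ} (ht : 10 < t) :
    |(Lam (crit t)).re| < 0.19 * (Lam (crit t)).im := by
  have ht0 : 0 < t := by linarith
  have hre : (crit t).re ≤ 6 := by rw [crit_re]; norm_num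
  have him : 0 < (crit t).im := by rwa [crit_im]
  set N := Complex.normSq (crit t) with hN
  have hN_eq : N = 1 / 4 + t ^ 2 := by
    rw [hN, Complex.normSq_apply, crit_re, crit_im]
    ring
  have hN0 : 0 < N := by
    rw [hN_eq]
    positivity
  calc |(Lam (crit t)).re| ≤ 1 / 2 / N + 2 / 19 / t := by
        rw [Lam_re, crit_re, ← hN, neg_div]
        refine (abs_add_le _ _).trans (add_le_add ?_ ?_)
        · rw [abs_neg, abs_of_pos (by positivity)]
        · simpa only [crit_im] using abs_re_thetaIntegral_le him hre
    _ < 0.19 * (t / N) := by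
        field_simp
        nlinarith
    _ ≤ 0.19 * (Lam (crit t)).im := by
        rw [Lam_im, crit_im, ← hN]
        linarith [thetaIntegral_im_nonneg him hre]

theorem abs_argLam_sub_lt {t : ℝ} (ht : 10 < t) : |argLam t - Real.pi / 2| < 0.19 := by
  have ht0 : 0 < t := by linarith
  have him := Lam_crit_im_pos ht0
  rw [argLam_eq_pi_div_two_sub_arctan ht0, sub_sub_cancel_left, abs_neg]
  refine (abs_arctan_le _).trans_lt ?_
  rw [abs_div, abs_of_pos him, div_lt_iff₀ him]
  exact abs_re_Lam_crit_lt ht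

theorem isArgLam_argLam : IsArgLam argLam where
  continuous := continuous_argLam
  ne_zero := Lam_crit_ne_zero
  polar := argLam_polar
  near _ := abs_argLam_sub_lt

/-- The factor `u(t)` in `Z(t) = u(t) (π / 2 - arg Λ(1/2 + it))`. Writing `x` for the second
factor, `Z(t)` is a positive multiple of `Re Λ(1/2 + it)`, hence of `sin x`. -/
noncomputable def zFactor (t : ℝ) : ℝ :=
  2 * ‖Lam (crit t)‖ / ‖Complex.Gammaℝ (crit t)‖ * Real.sinc (Real.pi / 2 - argLam t)

theorem zFactor_pos {t : ℝ} (ht : 0 < t) : 0 < zFactor t := by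
  have hΛ : 0 < ‖Lam (crit t)‖ := norm_pos_iff.2 (Lam_crit_ne_zero t)
  have hΓ : 0 < ‖Complex.Gammaℝ (crit t)‖ := norm_pos_iff.2 (Gammaℝ_crit_ne_zero t)
  have hsinc : 0 < Real.sinc (Real.pi / 2 - argLam t) := by
    rw [argLam_eq_pi_div_two_sub_arctan ht, sub_sub_cancel]
    refine sinc_pos (abs_lt.2 ⟨?_, ?_⟩)
    · linarith [Real.neg_pi_div_two_lt_arctan ((Lam (crit t)).re / (Lam (crit t)).im), Real.pi_pos]
    · linarith [Real.arctan_lt_pi_div_two ((Lam (crit t)).re / (Lam (crit t)).im), Real.pi_pos]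
  unfold zFactor
  positivity

theorem Z_eq_zFactor_mul (t : ℝ) : Z t = (zFactor t * (Real.pi / 2 - argLam t) : ℝ) := by
  have hre : (Lam (crit t)).re = ‖Lam (crit t)‖ * Real.cos (argLam t) := by
    simpa only [Complex.re_ofReal_mul, Complex.exp_ofReal_mul_I_re] using
      congrArg Complex.re (argLam_polar t)
  rw [Z_eq, zFactor, mul_assoc, sinc_mul_self, Real.sin_pi_div_two_sub, hre, ← mul_assoc,
    mul_div_right_comm]

end Argument

/-! ### The zeros of `s Λ(s)` -/

section ZeroIndex

variable {f : ℂ → ℂ}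

theorem encard_setOf_natCast_lt (m : ℕ∞) : {k : ℕ | (k : ℕ∞) < m}.encard = m := by
  induction m with
  | top => simp
  | coe n =>
    have hrange : {k : ℕ | (k : ℕ∞) < (n : ℕ∞)} = (Finset.range n : Set ℕ) := by
      ext k
      simp
    rw [hrange, Set.encard_coe_eq_coe_finsetCard, Finset.card_range]

/-- Pairs `(z, k)` with `k` less than the order of vanishing of `f` at `z`. They index the zeros of
`f`, each repeated according to its multiplicity. -/
def ZeroIndex (f : ℂ → ℂ) : Type :=
  {p : ℂ × ℕ // (p.2 : ℕ∞) < analyticOrderAt f p.1}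

/-- The zero of `f` that carries the index `i`. -/
def ZeroIndex.zero (i : ZeroIndex f) : ℂ := i.1.1

theorem isZeroFamily_zero : IsZeroFamily f (ZeroIndex.zero (f := f)) := by
  intro z
  rw [← encard_setOf_natCast_lt (analyticOrderAt f z)]
  refine Set.encard_congr ⟨fun i => ⟨i.1.1.2, i.1.2.trans_eq (congrArg _ i.2)⟩,
    fun k => ⟨⟨(z, k.1), k.2⟩, rfl⟩, ?_, ?_⟩
  · rintro ⟨⟨⟨w, k⟩, hk⟩, rfl⟩
    rfl
  · rintro ⟨k, hk⟩
    rfl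

theorem IsZeroFamily.encard_subtype {ι : Type*} {b : ι → ℂ} (hb : IsZeroFamily f b)
    {P : ℂ → Prop} {z : ℂ} (hz : P z) :
    {i : {i // P (b i)} | b i = z}.encard = analyticOrderAt f z := by
  rw [← hb, ← Subtype.val_injective.encard_image]
  congr 1
  ext i
  refine ⟨?_, fun hi => ⟨⟨i, ?_⟩, hi, rfl⟩⟩
  · rintro ⟨j, hj, rfl⟩
    exact hj
  · rwa [show b i = z from hi]

end ZeroIndex

section MonotoneEnumeration

theorem nonempty_orderIso_nat {S : Type*} [LinearOrder S] [Infinite S]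
    (hfin : ∀ a : S, (Iic a).Finite) : Nonempty (ℕ ≃o S) := by
  have : NoMaxOrder S := ⟨fun a => by
    by_contra! hmax
    exact Set.infinite_univ ((hfin a).subset fun c _ => hmax c)⟩
  obtain ⟨a⟩ : Nonempty S := inferInstance
  obtain ⟨m, -, hm⟩ := Set.exists_min_image _ id (hfin a) ⟨a, self_mem_Iic⟩
  let _ : OrderBot S :=
    { bot := m
      bot_le := fun c => (le_total c a).elim (hm c) (hm a self_mem_Iic).trans }
  let _ : LocallyFiniteOrder S :=
    LocallyFiniteOrder.ofFiniteIcc fun _ c => (hfin c).subset Icc_subset_Iic_self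
  let _ : SuccOrder S := LinearLocallyFiniteOrder.succOrder S
  let _ : PredOrder S := LinearLocallyFiniteOrder.predOrder S
  exact ⟨(orderIsoNatOfLinearSuccPredArch (ι := S)).symm⟩

theorem exists_monotone_comp_equiv {S : Type*} [Infinite S] {v : S → ℝ}
    (hv : ∀ R, {i | v i ≤ R}.Finite) : ∃ e : ℕ ≃ S, Monotone fun n => v (e n) := by
  have hcover : (⋃ n : ℕ, {i | v i ≤ n}) = univ :=
    Set.eq_univ_of_forall fun i => Set.mem_iUnion.2 (exists_nat_ge (v i))
  have : Countable S :=
    Set.countable_univ_iff.1 (hcover ▸ Set.countable_iUnion fun n => (hv n).countable)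
  obtain ⟨c, hc⟩ := exists_injective_nat S
  -- Ties of `v` are broken by the injection `c`.
  let lex : S → ℝ ×ₗ ℕ := fun i => toLex (v i, c i)
  have hlex : Function.Injective lex := fun i j h => hc (congrArg (fun p => (ofLex p).2) h)
  have hle {i j : S} (h : lex i ≤ lex j) : v i ≤ v j := Prod.Lex.monotone_fst_ofLex h
  let _ : LinearOrder S := LinearOrder.lift' lex hlex
  obtain ⟨e⟩ := nonempty_orderIso_nat fun a : S => (hv (v a)).subset fun i hi => hle hi
  exact ⟨e.toEquiv, fun m n hmn => hle (e.monotone hmn)⟩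

end MonotoneEnumeration

section Conjugation

variable {f : ℂ → ℂ}

theorem le_analyticOrderAt_conj (hf : Differentiable ℂ f)
    (hconj : ∀ s, f (starRingEnd ℂ s) = starRingEnd ℂ (f s)) (z : ℂ) :
    analyticOrderAt f z ≤ analyticOrderAt f (starRingEnd ℂ z) := by
  refine ENat.forall_natCast_le_iff_le.1 fun n hn => ?_
  rw [natCast_le_analyticOrderAt (hf.analyticAt _)] at hn ⊢
  obtain ⟨g, hg, hfg⟩ := hn
  have hcont : Tendsto (starRingEnd ℂ) (𝓝 (starRingEnd ℂ z)) (𝓝 z) := by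
    simpa using Complex.continuous_conj.tendsto (starRingEnd ℂ z)
  refine ⟨fun w => starRingEnd ℂ (g (starRingEnd ℂ w)), ?_, ?_⟩
  · rw [Complex.analyticAt_iff_eventually_differentiableAt] at hg ⊢
    filter_upwards [hcont.eventually hg] with w hw
    simpa [Function.comp_def] using hw.conj_conj
  · filter_upwards [hcont.eventually hfg] with w hw
    simpa [hconj] using congrArg (starRingEnd ℂ) hw

theorem analyticOrderAt_conj (hf : Differentiable ℂ f)
    (hconj : ∀ s, f (starRingEnd ℂ s) = starRingEnd ℂ (f s)) (z : ℂ) :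
    analyticOrderAt f (starRingEnd ℂ z) = analyticOrderAt f z :=
  le_antisymm (by simpa using le_analyticOrderAt_conj hf hconj (starRingEnd ℂ z))
    (le_analyticOrderAt_conj hf hconj z)

end Conjugation

section FiniteZeros

variable {ι : Type*} {f : ℂ → ℂ} {b : ι → ℂ}

theorem IsZeroFamily.finite_index (hb : IsZeroFamily f b) (hf : Differentiable ℂ f)
    (h0 : f 0 ≠ 0) (hzeros : {z | f z = 0}.Finite) : Finite ι := by
  obtain ⟨R, hR⟩ := hzeros.isBounded.exists_norm_le
  rw [← Set.finite_univ_iff]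
  exact (hb.finite_norm_le hf h0 R).subset fun i _ => hR _ (hb.apply_eq_zero i)

theorem norm_one_sub_mul_exp_le (w : ℂ) :
    ‖(1 - w) * Complex.exp w‖ ≤ Real.exp (2 * ‖w‖) := by
  have hsub : ‖1 - w‖ ≤ Real.exp ‖w‖ := by
    refine (norm_sub_le 1 w).trans ?_
    rw [norm_one, add_comm]
    exact Real.add_one_le_exp _
  rw [norm_mul, two_mul, Real.exp_add]
  exact mul_le_mul hsub (Complex.norm_exp_le_exp_norm w) (norm_nonneg _) (Real.exp_pos _).le

theorem exists_norm_le_exp_mul_of_finite_zeros (hf : Differentiable ℂ f) (h0 : f 0 = 1)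
    {C ρ : ℝ} (hC : 0 < C) (hρ : 0 ≤ ρ) (hρ2 : ρ < 2)
    (hgrowth : ∀ s, ‖f s‖ ≤ Real.exp (C * (1 + ‖s‖) ^ ρ)) (hzeros : {z | f z = 0}.Finite) :
    ∃ K, 0 ≤ K ∧ ∀ s, ‖f s‖ ≤ Real.exp (K * ‖s‖) := by
  have hb := isZeroFamily_zero (f := f)
  have := hb.finite_index hf (by simp [h0]) hzeros
  have := Fintype.ofFinite (ZeroIndex f)
  refine ⟨∑ i : ZeroIndex f, 2 / ‖i.zero‖ + ‖deriv f 0‖, by positivity, fun s => ?_⟩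
  have hfac : f s = (∏ i : ZeroIndex f, (1 - s / i.zero) * Complex.exp (s / i.zero))
      * Complex.exp (deriv f 0 * s) := by
    rw [← (hb.hasProd_of_norm_le_exp_rpow hf h0 hC hρ hρ2 hgrowth s).unique (hasProd_fintype _),
      mul_assoc, ← Complex.exp_add, neg_add_cancel, Complex.exp_zero, mul_one]
  rw [hfac, norm_mul, norm_prod, add_mul, Real.exp_add, Finset.sum_mul, Real.exp_sum]
  refine mul_le_mul (Finset.prod_le_prod (fun _ _ => norm_nonneg _) fun i _ => ?_)
    ((Complex.norm_exp_le_exp_norm _).trans_eq (by rw [norm_mul])) (norm_nonneg _)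
    (Finset.prod_nonneg fun _ _ => (Real.exp_pos _).le)
  refine (norm_one_sub_mul_exp_le _).trans_eq ?_
  rw [norm_div]
  ring_nf

end FiniteZeros

section RealZero

theorem hasDerivAt_sLam (s : ℂ) :
    HasDerivAt sLam (thetaIntegral s + s * deriv thetaIntegral s) s :=
  (((hasDerivAt_id s).fun_mul (differentiable_thetaIntegral s).hasDerivAt).const_add
    (-1)).congr_deriv (by rw [one_mul, id])

theorem exists_real_zero : ∃ β : ℝ, sLam β = 0 := by
  obtain ⟨σ, -, hσ⟩ := exists_exp_mul_lt_re_sLam le_rfl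
  have hcont : Continuous fun σ : ℝ => (sLam σ).re :=
    Complex.continuous_re.comp (differentiable_sLam.continuous.comp Complex.continuous_ofReal)
  obtain ⟨β, hβ⟩ := mem_range_of_exists_le_of_exists_ge hcont
    ⟨0, (re_sLam_neg zero_le_one).le⟩ ⟨σ, (Real.exp_pos _).le.trans hσ.le⟩
  exact ⟨β, by rw [sLam_ofReal, show (sLam β).re = 0 from hβ, Complex.ofReal_zero]⟩

theorem one_lt_re_of_sLam_eq_zero {z : ℂ} (h : sLam z = 0) : 1 < z.re :=
  not_le.1 fun hre => sLam_ne_zero hre h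

theorem mul_re_thetaIntegral_eq_one {β : ℝ} (hβ : sLam β = 0) :
    β * (thetaIntegral β).re = 1 := by
  have hre := re_sLam_ofReal β
  rw [hβ, Complex.zero_re] at hre
  linarith

theorem eq_of_sLam_ofReal_eq_zero {β γ : ℝ} (hβ : sLam β = 0) (hγ : sLam γ = 0) : β = γ := by
  wlog hle : β ≤ γ generalizing β γ
  · exact (this hγ hβ (le_of_not_ge hle)).symm
  refine hle.antisymm (not_lt.1 fun hlt => ?_)
  have hβ0 : 0 < β := one_pos.trans (one_lt_re_of_sLam_eq_zero hβ)
  have hβ1 := mul_re_thetaIntegral_eq_one hβ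
  have hmono := thetaIntegral_re_mono hle
  refine absurd (mul_re_thetaIntegral_eq_one hγ) (ne_of_gt ?_)
  calc 1 = β * (thetaIntegral β).re := hβ1.symm
    _ < γ * (thetaIntegral β).re := by
        gcongr
        exact pos_of_mul_pos_right (hβ1 ▸ one_pos) hβ0.le
    _ ≤ γ * (thetaIntegral γ).re := mul_le_mul_of_nonneg_left hmono (hβ0.trans hlt).le

theorem deriv_sLam_ne_zero {β : ℝ} (hβ : sLam β = 0) : deriv sLam β ≠ 0 := by
  have hβ0 : 0 < β := one_pos.trans (one_lt_re_of_sLam_eq_zero hβ)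
  have hpos : 0 < (thetaIntegral β).re :=
    pos_of_mul_pos_right ((mul_re_thetaIntegral_eq_one hβ).symm ▸ one_pos) hβ0.le
  have hderiv : 0 ≤ (deriv thetaIntegral β).re := by
    rw [← (differentiable_thetaIntegral (β : ℂ)).hasDerivAt.real_of_complex.deriv]
    exact thetaIntegral_re_mono.deriv_nonneg
  refine ne_of_apply_ne Complex.re (ne_of_gt ?_)
  rw [(hasDerivAt_sLam β).deriv, Complex.add_re, Complex.re_ofReal_mul, Complex.zero_re]
  positivity

theorem analyticOrderAt_sLam_of_real_zero {β : ℝ} (hβ : sLam β = 0) :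
    analyticOrderAt sLam β = 1 := by
  simpa [hβ] using (differentiable_sLam.analyticAt β).analyticOrderAt_sub_eq_one_of_deriv_ne_zero
    (deriv_sLam_ne_zero hβ)

end RealZero

section NonrealZeros

theorem neg_sLam_zero : (-sLam) 0 = 1 := by
  rw [Pi.neg_apply, sLam_zero, neg_neg]

theorem norm_neg_sLam_le (s : ℂ) : ‖(-sLam) s‖ ≤ Real.exp (3 * (1 + ‖s‖) ^ (3 / 2 : ℝ)) := by
  rw [Pi.neg_apply, norm_neg]
  exact norm_sLam_le s

theorem infinite_zeros_sLam : {z | sLam z = 0}.Infinite := by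
  intro hfin
  obtain ⟨K, hK, hle⟩ := exists_norm_le_exp_mul_of_finite_zeros differentiable_sLam.neg
    neg_sLam_zero three_pos (by norm_num) (by norm_num) norm_neg_sLam_le
    (by simpa only [Pi.neg_apply, neg_eq_zero] using hfin)
  obtain ⟨σ, hσ, hlt⟩ := exists_exp_mul_lt_re_sLam hK
  have hre := Complex.re_le_norm (sLam σ)
  have hσle := hle σ
  rw [Pi.neg_apply, norm_neg, Complex.norm_of_nonneg hσ.le] at hσle
  linarith

theorem infinite_zeros_sLam_im_pos : {z | sLam z = 0 ∧ 0 < z.im}.Infinite := by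
  intro hfin
  obtain ⟨β, hβ⟩ := exists_real_zero
  refine infinite_zeros_sLam (((hfin.union (hfin.image (starRingEnd ℂ))).insert (β : ℂ)).subset ?_)
  intro z hz
  rcases lt_trichotomy z.im 0 with him | him | him
  · refine .inr (.inr ⟨starRingEnd ℂ z, ⟨?_, by simpa using him⟩, Complex.conj_conj z⟩)
    rw [sLam_conj, show sLam z = 0 from hz, map_zero]
  · have hreal : (z.re : ℂ) = z := Complex.conj_eq_iff_re.1 (Complex.conj_eq_iff_im.2 him)
    left
    rw [eq_of_sLam_ofReal_eq_zero hβ (hreal.symm ▸ hz), hreal]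
  · exact .inr (.inl ⟨hz, him⟩)

end NonrealZeros

section Enumeration

/-- The enumeration over `ℤ` with `b 0 = β`, `b (k + 1) = u k` and `b (-(k + 1)) = conj (u k)`. It
arranges the zeros of `s Λ(s)` as the theorem requires, from the real zero `β` and the zeros `u k`
in the upper half plane. -/
noncomputable def conjEnumeration (β : ℝ) (u : ℕ → ℂ) : ℤ → ℂ
  | Int.ofNat 0 => β
  | Int.ofNat (k + 1) => u k
  | Int.negSucc k => starRingEnd ℂ (u k)

variable {β : ℝ} {u : ℕ → ℂ}

theorem conjEnumeration_neg (β : ℝ) (u : ℕ → ℂ) (n : ℤ) :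
    conjEnumeration β u (-n) = starRingEnd ℂ (conjEnumeration β u n) := by
  match n with
  | Int.ofNat 0 => exact (Complex.conj_ofReal β).symm
  | Int.ofNat (k + 1) => rfl
  | Int.negSucc k => exact (Complex.conj_conj (u k)).symm

theorem conjEnumeration_im_pos_iff (hu : ∀ k, 0 < (u k).im) (n : ℤ) :
    0 < (conjEnumeration β u n).im ↔ 0 < n := by
  match n with
  | Int.ofNat 0 => simp [conjEnumeration]
  | Int.ofNat (k + 1) => exact iff_of_true (hu k) (Int.natCast_pos.2 k.succ_pos)
  | Int.negSucc k =>
    refine iff_of_false (not_lt.2 ?_) (Int.negSucc_lt_zero k).not_gt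
    rw [conjEnumeration, Complex.conj_im]
    exact neg_nonpos.2 (hu k).le

theorem conjEnumeration_im_eq_zero_iff (hu : ∀ k, 0 < (u k).im) (n : ℤ) :
    (conjEnumeration β u n).im = 0 ↔ n = 0 := by
  have hpos := conjEnumeration_im_pos_iff (β := β) hu n
  have hneg := conjEnumeration_im_pos_iff (β := β) hu (-n)
  rw [conjEnumeration_neg, Complex.conj_im, neg_pos, neg_pos] at hneg
  rw [← not_iff_not, ← ne_eq, ← ne_eq, ne_iff_lt_or_gt, ne_iff_lt_or_gt, hpos, hneg]

theorem encard_conjEnumeration_of_im_pos (hu : ∀ k, 0 < (u k).im) {z : ℂ} (hz : 0 < z.im) :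
    {n | conjEnumeration β u n = z}.encard = {k | u k = z}.encard := by
  have hinj : Function.Injective fun k : ℕ => (k + 1 : ℤ) := fun k l h => by simpa using h
  rw [← hinj.encard_image]
  congr 1
  ext n
  constructor
  · rintro rfl
    obtain ⟨k, rfl⟩ := Int.eq_succ_of_zero_lt ((conjEnumeration_im_pos_iff hu n).1 hz)
    exact ⟨k, rfl, rfl⟩
  · rintro ⟨k, hk, rfl⟩
    exact hk

theorem encard_conjEnumeration_conj (β : ℝ) (u : ℕ → ℂ) (z : ℂ) :
    {n | conjEnumeration β u n = starRingEnd ℂ z}.encard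
      = {n | conjEnumeration β u n = z}.encard := by
  rw [← Set.encard_preimage_of_bijective (Equiv.neg ℤ).bijective {n | conjEnumeration β u n = z}]
  congr 1
  ext n
  simp only [mem_ofPred_eq, mem_preimage, Equiv.neg_apply, conjEnumeration_neg]
  exact eq_comm.trans star_eq_iff_star_eq

theorem setOf_conjEnumeration_eq_ofReal (hu : ∀ k, 0 < (u k).im) (x : ℝ) :
    {n | conjEnumeration β u n = x} = {n | n = 0 ∧ β = x} := by
  ext n
  constructor
  · intro hn
    obtain rfl := (conjEnumeration_im_eq_zero_iff hu n).1 (by rw [hn, Complex.ofReal_im])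
    exact ⟨rfl, Complex.ofReal_injective hn⟩
  · rintro ⟨rfl, rfl⟩
    rfl

theorem isZeroFamily_conjEnumeration {f : ℂ → ℂ}
    (hconj : ∀ z, analyticOrderAt f (starRingEnd ℂ z) = analyticOrderAt f z)
    (hβ : analyticOrderAt f β = 1) (hreal : ∀ x : ℝ, f x = 0 → β = x) (hu : ∀ k, 0 < (u k).im)
    (hupper : ∀ z : ℂ, 0 < z.im → {k | u k = z}.encard = analyticOrderAt f z) :
    IsZeroFamily f (conjEnumeration β u) := by
  intro z
  rcases lt_trichotomy z.im 0 with him | him | him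
  · have him' : 0 < (starRingEnd ℂ z).im := by simpa using him
    rw [← encard_conjEnumeration_conj, encard_conjEnumeration_of_im_pos hu him',
      hupper _ him', hconj]
  · obtain ⟨x, rfl⟩ := Complex.conj_eq_iff_real.1 (Complex.conj_eq_iff_im.2 him)
    rw [setOf_conjEnumeration_eq_ofReal hu]
    by_cases hx : β = x
    · simp [← hx, hβ]
    · rw [analyticOrderAt_eq_zero.2 (.inr fun h => hx (hreal x h))]
      simp [hx]
  · rw [encard_conjEnumeration_of_im_pos hu him, hupper z him]

theorem exists_monotone_zeros_sLam_im_pos :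
    ∃ u : ℕ → ℂ, (∀ k, 0 < (u k).im) ∧ (Monotone fun k => ‖u k‖) ∧
      ∀ z : ℂ, 0 < z.im → {k | u k = z}.encard = analyticOrderAt sLam z := by
  let Upper := {i : ZeroIndex sLam // 0 < i.zero.im}
  have hfin (R : ℝ) : {i : Upper | ‖i.1.zero‖ ≤ R}.Finite :=
    (isZeroFamily_zero.finite_norm_le differentiable_sLam (sLam_ne_zero (by simp)) R).preimage
      Subtype.val_injective.injOn
  have hinf : Infinite Upper := by
    have hzeros := infinite_zeros_sLam_im_pos.to_subtype
    refine Infinite.of_surjective (β := {z | sLam z = 0 ∧ 0 < z.im})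
      (fun i : Upper => ⟨i.1.zero, isZeroFamily_zero.apply_eq_zero i.1, i.2⟩) ?_
    rintro ⟨z, hz, him⟩
    obtain ⟨i, rfl⟩ := isZeroFamily_zero.exists_eq differentiable_sLam hz
    exact ⟨⟨i, him⟩, rfl⟩
  obtain ⟨e, he⟩ := exists_monotone_comp_equiv hfin
  refine ⟨fun k => (e k).1.zero, fun k => (e k).2, he, fun z hz => ?_⟩
  rw [← isZeroFamily_zero.encard_subtype (P := fun z => 0 < z.im) hz]
  exact Set.encard_preimage_of_bijective e.bijective {i : Upper | i.1.zero = z}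

theorem exists_isZeroEnumeration : ∃ b : ℤ → ℂ, IsZeroEnumeration b := by
  obtain ⟨β, hβ⟩ := exists_real_zero
  obtain ⟨u, hu, hmono, hupper⟩ := exists_monotone_zeros_sLam_im_pos
  refine ⟨conjEnumeration β u, ?_, conjEnumeration_im_eq_zero_iff hu, conjEnumeration_neg β u, ?_⟩
  · exact isZeroFamily_conjEnumeration (analyticOrderAt_conj differentiable_sLam sLam_conj)
      (analyticOrderAt_sLam_of_real_zero hβ) (fun _ => eq_of_sLam_ofReal_eq_zero hβ) hu hupper
  · intro n hn
    obtain ⟨k, rfl⟩ := Int.eq_succ_of_zero_lt hn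
    exact hmono k.le_succ

end Enumeration

/-! ### The sum of the arguments over the zeros -/

section ArgSeries

open scoped ComplexOrder in
theorem one_sub_div_mem_slitPlane {s z : ℂ} (hs : 0 < s.re) (hz : s.re < z.re) :
    1 - s / z ∈ Complex.slitPlane := by
  rw [Complex.mem_slitPlane_iff_not_le_zero, sub_nonpos]
  intro hle
  have hz0 : z ≠ 0 := ne_of_apply_ne Complex.re (hs.trans hz).ne'
  obtain ⟨r, hr⟩ : ∃ r : ℝ, s / z = r :=
    Complex.conj_eq_iff_real.1 (Complex.conj_eq_iff_im.2 (Complex.le_def.1 hle).2.symm)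
  have hr1 : 1 ≤ r := by rwa [hr, ← Complex.ofReal_one, Complex.real_le_real] at hle
  rw [div_eq_iff hz0] at hr
  have hre : s.re = r * z.re := by rw [hr, Complex.re_ofReal_mul]
  nlinarith

theorem norm_log_one_sub_add_le {w : ℂ} (hw : ‖w‖ ≤ 1 / 2) :
    ‖Complex.log (1 - w) + w‖ ≤ ‖w‖ ^ 2 := by
  have hlog := Complex.norm_log_one_add_sub_self_le (z := -w) (by rw [norm_neg]; linarith)
  rw [norm_neg, sub_neg_eq_add, ← sub_eq_add_neg] at hlog
  have hinv : (1 - ‖w‖)⁻¹ ≤ 2 := inv_le_of_inv_le₀ two_pos (by linarith)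
  nlinarith [mul_le_mul_of_nonneg_left hinv (sq_nonneg ‖w‖)]

theorem abs_arg_one_sub_add_im_le (w : ℂ) :
    |Complex.arg (1 - w) + w.im| ≤ 16 * ‖w‖ ^ 2 := by
  rcases le_or_gt ‖w‖ (1 / 2) with hw | hw
  · have hlog := (Complex.abs_im_le_norm _).trans (norm_log_one_sub_add_le hw)
    rw [Complex.add_im, Complex.log_im] at hlog
    nlinarith [sq_nonneg ‖w‖]
  · have harg := Complex.abs_arg_le_pi (1 - w)
    have him := Complex.abs_im_le_norm w
    have htri := abs_add_le (Complex.arg (1 - w)) w.im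
    nlinarith [Real.pi_lt_d2]

theorem abs_argTerm_le (b : ℤ → ℂ) (t : ℝ) (n : ℤ) :
    |argTerm b t n| ≤ 16 * ‖crit t‖ ^ 2 * (‖b n‖ ^ 2)⁻¹ := by
  refine (abs_arg_one_sub_add_im_le _).trans_eq ?_
  rw [norm_div, div_pow, div_eq_mul_inv, mul_assoc]

namespace IsZeroEnumeration

variable {b : ℤ → ℂ}

theorem isZeroFamily (hb : IsZeroEnumeration b) : IsZeroFamily (-sLam) b := fun z => by
  rw [hb.multiplicity, analyticOrderAt_neg]

theorem summable_inv_norm_sq (hb : IsZeroEnumeration b) : Summable fun n => (‖b n‖ ^ 2)⁻¹ :=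
  hb.isZeroFamily.summable_inv_norm_sq differentiable_sLam.neg neg_sLam_zero three_pos.le
    (by norm_num) (by norm_num) norm_neg_sLam_le

theorem hasProd (hb : IsZeroEnumeration b) (s : ℂ) :
    HasProd (fun n => (1 - s / b n) * Complex.exp (s / b n))
      (-sLam s * Complex.exp (thetaIntegral 0 * s)) := by
  have hderiv : deriv (-sLam) 0 = -thetaIntegral 0 := by simpa using (hasDerivAt_sLam 0).neg.deriv
  have hprod := hb.isZeroFamily.hasProd_of_norm_le_exp_rpow differentiable_sLam.neg neg_sLam_zero
    three_pos (by norm_num) (by norm_num) norm_neg_sLam_le s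
  rwa [hderiv, neg_mul, neg_neg, Pi.neg_apply] at hprod

theorem Lam_eq (hb : IsZeroEnumeration b) {s : ℂ} (hs : s ≠ 0) :
    Lam s = -(Complex.exp (-(thetaIntegral 0 * s)) / s) *
      ∏' n : ℤ, (1 - s / b n) * Complex.exp (s / b n) := by
  rw [(hb.hasProd s).tprod_eq, sLam_eq hs, Complex.exp_neg]
  have hexp := Complex.exp_ne_zero (thetaIntegral 0 * s)
  field_simp

theorem mem_slitPlane (hb : IsZeroEnumeration b) (t : ℝ) (n : ℤ) :
    1 - crit t / b n ∈ Complex.slitPlane := by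
  have hzero : sLam (b n) = 0 := neg_eq_zero.1 (hb.isZeroFamily.apply_eq_zero n)
  exact one_sub_div_mem_slitPlane (by rw [crit_re]; norm_num)
    (by rw [crit_re]; linarith [one_lt_re_of_sLam_eq_zero hzero])

theorem summable_argTerm (hb : IsZeroEnumeration b) (t : ℝ) : Summable (argTerm b t) :=
  .of_norm_bounded (hb.summable_inv_norm_sq.mul_left (16 * ‖crit t‖ ^ 2)) (abs_argTerm_le b t)

theorem continuous_argTerm (hb : IsZeroEnumeration b) (n : ℤ) :
    Continuous fun t => argTerm b t n := by
  have hdiv : Continuous fun t => crit t / b n := continuous_crit.div_const _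
  refine (continuous_iff_continuousAt.2 fun t => ?_).add (Complex.continuous_im.comp hdiv)
  exact (Complex.continuousAt_arg (hb.mem_slitPlane t n)).comp
    (f := fun t => 1 - crit t / b n) (continuous_const.sub hdiv).continuousAt

theorem continuous_tsum_argTerm (hb : IsZeroEnumeration b) :
    Continuous fun t => ∑' n, argTerm b t n := by
  refine continuous_iff_continuousAt.2 fun t₀ => ?_
  have hopen : IsOpen {t | ‖crit t‖ < ‖crit t₀‖ + 1} :=
    isOpen_lt continuous_crit.norm continuous_const
  refine (continuousOn_tsum (fun n => (hb.continuous_argTerm n).continuousOn)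
    (hb.summable_inv_norm_sq.mul_left (16 * (‖crit t₀‖ + 1) ^ 2))
    fun n t ht => (abs_argTerm_le b t n).trans ?_).continuousAt
      (hopen.mem_nhds (lt_add_one ‖crit t₀‖))
  have hle : ‖crit t‖ ≤ ‖crit t₀‖ + 1 := le_of_lt ht
  gcongr

theorem argTerm_neg (hb : IsZeroEnumeration b) (n : ℤ) : argTerm b 0 (-n) = -argTerm b 0 n := by
  have hdiv : crit 0 / b (-n) = starRingEnd ℂ (crit 0 / b n) := by
    rw [map_div₀, ← crit_neg, neg_zero, hb.conj]
  have hsub : 1 - crit 0 / b (-n) = starRingEnd ℂ (1 - crit 0 / b n) := by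
    rw [hdiv, map_sub, map_one]
  rw [argTerm, argTerm, hsub, hdiv, Complex.arg_conj,
    if_neg (Complex.mem_slitPlane_iff_arg.1 (hb.mem_slitPlane 0 n)).1, Complex.conj_im, neg_add]

theorem tsum_argTerm_zero (hb : IsZeroEnumeration b) : ∑' n, argTerm b 0 n = 0 := by
  have hneg := (Equiv.neg ℤ).tsum_eq (argTerm b 0)
  simp only [Equiv.neg_apply, hb.argTerm_neg, tsum_neg] at hneg
  linarith

theorem bracket_zero (hb : IsZeroEnumeration b) (α : ℝ) : bracket α b 0 = -(Real.pi / 2) := by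
  simp [bracket, hb.tsum_argTerm_zero]

theorem continuous_bracket (hb : IsZeroEnumeration b) (α : ℝ) : Continuous (bracket α b) := by
  refine Continuous.sub ?_ hb.continuous_tsum_argTerm
  exact (continuous_const.add (continuous_const.mul continuous_id)).add
    (Real.continuous_arctan.comp (continuous_const.mul continuous_id))

theorem summable_log (hb : IsZeroEnumeration b) (t : ℝ) :
    Summable fun n => Complex.log (1 - crit t / b n) + crit t / b n := by
  refine .of_norm_bounded_eventually (hb.summable_inv_norm_sq.mul_left (‖crit t‖ ^ 2)) ?_
  have hlim := (hb.summable_inv_norm_sq.mul_left (‖crit t‖ ^ 2)).tendsto_cofinite_zero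
  filter_upwards [hlim.eventually_le_const (show (0 : ℝ) < (1 / 2) ^ 2 by norm_num)] with n hn
  rw [← div_eq_mul_inv, ← div_pow, ← norm_div] at hn ⊢
  exact norm_log_one_sub_add_le (le_of_sq_le_sq hn (by norm_num))

end IsZeroEnumeration

theorem arg_crit (t : ℝ) : (crit t).arg = Real.arctan (2 * t) := by
  rw [arg_eq_arctan (by rw [crit_re]; norm_num), crit_re, crit_im, div_div_eq_mul_div, div_one,
    mul_comm]

theorem coe_arg_exp (w : ℂ) : ((Complex.exp w).arg : Real.Angle) = w.im := by
  rw [Complex.arg_exp]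
  exact Real.Angle.coe_toIocMod _ _

namespace IsZeroEnumeration

variable {b : ℤ → ℂ} {α : ℝ}

theorem exists_neg_Lam_crit_eq_exp (hb : IsZeroEnumeration b) (hα : (α : ℂ) = thetaIntegral 0)
    (t : ℝ) : ∃ w : ℂ, -Lam (crit t) = Complex.exp w ∧ bracket α b t = -(Real.pi / 2) - w.im := by
  obtain ⟨S, hS⟩ := hb.summable_log t
  have hexp : ∏' n, (1 - crit t / b n) * Complex.exp (crit t / b n) = Complex.exp S := by
    refine (hS.cexp.congr_fun fun n => ?_).tprod_eq
    rw [Function.comp_apply, Complex.exp_add,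
      Complex.exp_log (Complex.slitPlane_ne_zero (hb.mem_slitPlane t n))]
  have him : ∑' n, argTerm b t n = S.im := by
    refine ((Complex.hasSum_im hS).congr_fun fun n => ?_).tsum_eq
    rw [argTerm, Complex.add_im, Complex.log_im]
  refine ⟨-(α * crit t) - Complex.log (crit t) + S, ?_, ?_⟩
  · rw [hb.Lam_eq (crit_ne_zero t), hexp, ← hα, Complex.exp_add, Complex.exp_sub,
      Complex.exp_log (crit_ne_zero t), neg_mul, neg_neg]
  · rw [Complex.add_im, Complex.sub_im, Complex.neg_im, Complex.im_ofReal_mul, crit_im,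
      Complex.log_im, arg_crit, bracket, him]
    ring

theorem coe_bracket (hb : IsZeroEnumeration b) (hα : (α : ℂ) = thetaIntegral 0) (t : ℝ) :
    (bracket α b t : Real.Angle) = (Real.pi / 2 - argLam t : ℝ) := by
  obtain ⟨w, hw, hbracket⟩ := hb.exists_neg_Lam_crit_eq_exp hα t
  have hsub : Real.pi / 2 - (Real.pi + (Complex.exp w).arg)
      = -(Real.pi / 2) - (Complex.exp w).arg := by ring
  rw [hbracket, argLam, hw, hsub, Real.Angle.coe_sub, Real.Angle.coe_sub, coe_arg_exp]

theorem bracket_eq (hb : IsZeroEnumeration b) (hα : (α : ℂ) = thetaIntegral 0) :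
    bracket α b = fun t => Real.pi / 2 - argLam t :=
  (AddCircle.isCoveringMap_coe (2 * Real.pi)).eq_of_comp_eq (hb.continuous_bracket α)
    (continuous_const.sub continuous_argLam) (funext (hb.coe_bracket hα)) 0
    (by rw [hb.bracket_zero, argLam_zero]; ring)

end IsZeroEnumeration

end ArgSeries

end RiemannSiegelExpr

theorem mainTheorem1 :
    (∃ b : ℤ → ℂ, RiemannSiegelExpr.IsZeroEnumeration b) ∧
    ∃ (α : ℝ) (φ u : ℝ → ℝ),
      (α : ℂ) = RiemannSiegelExpr.thetaIntegral 0 ∧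
      RiemannSiegelExpr.IsArgLam φ ∧
      (∀ t : ℝ, 0 < t → 0 < u t) ∧
      ∀ b : ℤ → ℂ, RiemannSiegelExpr.IsZeroEnumeration b →
        (∀ s : ℂ, s ≠ 0 →
          Multipliable (fun n : ℤ => (1 - s / b n) * Complex.exp (s / b n)) ∧
          RiemannSiegelExpr.Lam s =
            -(Complex.exp (-((α : ℂ) * s)) / s) *
              ∏' n : ℤ, (1 - s / b n) * Complex.exp (s / b n)) ∧
        ∀ t : ℝ,
          (∀ n : ℤ, 1 - RiemannSiegelExpr.crit t / b n ∈ Complex.slitPlane) ∧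
          Summable (RiemannSiegelExpr.argTerm b t) ∧
          RiemannSiegelExpr.Z t = ((u t * RiemannSiegelExpr.bracket α b t : ℝ) : ℂ) ∧
          RiemannSiegelExpr.bracket α b t = Real.pi / 2 - φ t := by
  have hα : ((RiemannSiegelExpr.thetaIntegral 0).re : ℂ) = RiemannSiegelExpr.thetaIntegral 0 := by
    simpa only [Complex.ofReal_zero] using (RiemannSiegelExpr.thetaIntegral_ofReal 0).symm
  refine ⟨RiemannSiegelExpr.exists_isZeroEnumeration, (RiemannSiegelExpr.thetaIntegral 0).re,
    RiemannSiegelExpr.argLam, RiemannSiegelExpr.zFactor, hα, RiemannSiegelExpr.isArgLam_argLam,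
    fun _ => RiemannSiegelExpr.zFactor_pos, fun b hb => ?_⟩
  have hbracket := congrFun (hb.bracket_eq hα)
  refine ⟨fun s hs => ⟨(hb.hasProd s).multipliable, ?_⟩, fun t =>
    ⟨hb.mem_slitPlane t, hb.summable_argTerm t, ?_, hbracket t⟩⟩
  · rw [hα, hb.Lam_eq hs]
  · rw [hbracket, RiemannSiegelExpr.Z_eq_zFactor_mul]
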